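/- Let $\nu$ be a $\sigma$-finite measure on a measurable space $\mathcal{X}$, let $\Theta$ be a standard Borel space, and let $$P(z\mid\theta)=h(z)\,g(\theta)\exp(\eta(\theta)\cdot T(z))$$ be an exponential family of probability densities with respect to $\nu$, with measurable $h\ge 0$, $T:\mathcal{X}\to\mathbb{R}^d$ and $\eta:\Theta\to\mathbb{R}^d$. Write $g(x)=\big(\int h\,e^{x\cdot T}\,d\nu\big)^{-1}$ for $x$ in the natural parameter space $N=\{x\in\mathbb{R}^d:\int h\,e^{x\cdot T}\,d\nu<\infty\}$, so that $g(\theta)=g(\eta(\theta))$, and assume that the family is regular, i.e. that $N$ is open. Let $\theta^*$ be drawn from the conjugate prior with hyperparameters $n_0\in\mathbb{R}$ and $\tau_0\in\mathbb{R}^d$, assumed proper: $\eta(\theta^*)$ has on $N$ the Lebesgue density $$P(x)=\frac{1}{Z_0}\,g(x)^{n_0}\exp(x\cdot\tau_0),\qquad Z_0=\int_N g(x)^{n_0}\exp(x\cdot\tau_0)\,dx<\infty .$$ Given $\theta^*$, let the training set $Z=(z_1,\dots,z_n)$, $n\ge 1$, consist of $n$ independent examples from $\mathcal{D}=P(\cdot\mid\theta^*)$,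 and suppose $n+n_0>0$. Let $\ell(z,\theta)=-\log P(z\mid\theta)$ be log loss, and set $$\hat L(\theta)=\frac1n\sum_{i=1}^n\ell(z_i,\theta),\qquad \bar L(\theta,Z)=\mathbb{E}_{\theta^*}\big[\,\mathbb{E}_{z\sim P(\cdot\mid\theta^*)}[\ell(z,\theta)]\;\big|\;Z\big],\qquad R^*(\theta)=-\frac1n\log P(\eta(\theta)).$$ Assume that for almost every $Z$ the posterior expectation $\mathbb{E}_{\theta^*}\big[\mathbb{E}_{z\sim P(\cdot\mid\theta^*)}[\log h(z)]\mid Z\big]$ exists and is finite. Then for almost every training set $Z$, the expected test loss $\bar L(\theta,Z)$ exists and is finite for every $\theta\in\Theta$, and $R^*$ is a perfect, Bayes-optimal regularizer: $$\operatorname*{argmin}_{\theta\in\Theta}\{\hat L(\theta)+R^*(\theta)\}=\operatorname*{argmin}_{\theta\in\Theta}\{\bar L(\theta,Z)\}$$ (equality of the sets of minimizers), and there is a monotone function $\varphi:\mathbb{R}\to\mathbb{R}$ with $\hat L(\theta)+R^*(\theta)=\varphi(\bar L(\theta,Z))$ for all $\theta\in\Theta$. More precisely, there is a constant $K$, which may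 depend on $Z$ but not on $\theta$, such that $$\hat L(\theta)+R^*(\theta)=\frac{n+n_0}{n}\,\bar L(\theta,Z)+K\qquad\text{for all }\theta\in\Theta .$$ -/

import Mathlib

open MeasureTheory ProbabilityTheory

noncomputable section

/-- An exponential family `P(z | θ) = h(z) g(θ) exp ⟨η(θ), T(z)⟩` of probability densities with
respect to a σ-finite measure `ν`, where `T` and `η` have values in `ℝᵈ`.  The normaliser `g` is
determined by `h`, `η` and `T` (see `ExpFamily.normalizer`); the last two fields say that the
normalisation is possible. -/
structure ExpFamily {X : Type*} [MeasurableSpace X] (ν : Measure X)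
    (Θ : Type*) [MeasurableSpace Θ] (d : ℕ) where
  /-- the carrier function -/
  h : X → ℝ
  /-- the sufficient statistic -/
  T : X → EuclideanSpace ℝ (Fin d)
  /-- the natural parameter, as a function of the parameter -/
  η : Θ → EuclideanSpace ℝ (Fin d)
  measurable_h : Measurable h
  measurable_T : Measurable T
  measurable_η : Measurable η
  h_nonneg : ∀ z, 0 ≤ h z
  h_ne_zero : ¬ h =ᵐ[ν] 0
  integrable_η : ∀ θ, Integrable (fun z => h z * Real.exp (inner ℝ (η θ) (T z))) ν

/-- The set of minimizers of a real function. -/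
def argminSet {Θ : Type*} (f : Θ → ℝ) : Set Θ := {θ | ∀ θ', f θ ≤ f θ'}

/-- `R` is a Bayes-optimal regularizer for the training loss `Lhat` and the conditional expected
test loss `Lbar` (both at a given training set): regularized training loss and conditional expected
test loss have the same minimizers. -/
def IsBayesOptimal {Θ : Type*} (Lhat Lbar R : Θ → ℝ) : Prop :=
  argminSet (fun θ => Lhat θ + R θ) = argminSet Lbar

/-- `R` is a perfect, Bayes-optimal regularizer. -/
def IsPerfectBayesOptimal {Θ : Type*} (Lhat Lbar R : Θ → ℝ) : Prop :=
  IsBayesOptimal Lhat Lbar R ∧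
    ∃ φ : ℝ → ℝ, Monotone φ ∧ ∀ θ, Lhat θ + R θ = φ (Lbar θ)

namespace ExpFamily

variable {X : Type*} [MeasurableSpace X] {ν : Measure X}
  {Θ : Type*} [MeasurableSpace Θ] {d : ℕ}

/-- The natural parameter space: all `x ∈ ℝᵈ` for which `h(z) exp ⟨x, T(z)⟩` can be normalised. -/
def naturalSpace (E : ExpFamily ν Θ d) : Set (EuclideanSpace ℝ (Fin d)) :=
  {x | Integrable (fun z => E.h z * Real.exp (inner ℝ x (E.T z))) ν}

/-- The normaliser `g`, as a function of the natural parameter. -/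
def normalizer (E : ExpFamily ν Θ d) (x : EuclideanSpace ℝ (Fin d)) : ℝ :=
  (∫ z, E.h z * Real.exp (inner ℝ x (E.T z)) ∂ν)⁻¹

/-- The density `P(z | θ)` with respect to `ν`. -/
def density (E : ExpFamily ν Θ d) (θ : Θ) (z : X) : ℝ :=
  E.h z * E.normalizer (E.η θ) * Real.exp (inner ℝ (E.η θ) (E.T z))

/-- The distribution `𝒟 = P(· | θ)` of an example. -/
def law (E : ExpFamily ν Θ d) (θ : Θ) : Measure X :=
  ν.withDensity (fun z => ENNReal.ofReal (E.density θ z))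

/-- Log loss. -/
def loss (E : ExpFamily ν Θ d) (z : X) (θ : Θ) : ℝ := - Real.log (E.density θ z)

lemma integral_pos (E : ExpFamily ν Θ d) (θ : Θ) :
    0 < ∫ z, E.h z * Real.exp (inner ℝ (E.η θ) (E.T z)) ∂ν := by
  have h0 : 0 ≤ fun z => E.h z * Real.exp (inner ℝ (E.η θ) (E.T z)) :=
    fun z => mul_nonneg (E.h_nonneg z) (Real.exp_pos _).le
  refine lt_of_le_of_ne (integral_nonneg h0) (fun h => E.h_ne_zero ?_)
  have := (integral_eq_zero_iff_of_nonneg h0 (E.integrable_η θ)).1 h.symm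
  filter_upwards [this] with z hz
  simpa [(Real.exp_pos _).ne'] using hz

instance isProbabilityMeasure_law (E : ExpFamily ν Θ d) (θ : Θ) :
    IsProbabilityMeasure (E.law θ) := by
  have heq : E.density θ = fun z => E.normalizer (E.η θ) *
      (E.h z * Real.exp (inner ℝ (E.η θ) (E.T z))) := by
    funext z; simp only [density]; ring
  have hg : 0 ≤ E.normalizer (E.η θ) := inv_nonneg.2 (E.integral_pos θ).le
  refine ⟨?_⟩
  rw [law, withDensity_apply _ MeasurableSet.univ, Measure.restrict_univ, heq,
    ← ofReal_integral_eq_lintegral_ofReal ((E.integrable_η θ).const_mul _)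
      (Filter.Eventually.of_forall fun z =>
        mul_nonneg hg (mul_nonneg (E.h_nonneg z) (Real.exp_pos _).le)),
    integral_const_mul, normalizer, inv_mul_cancel₀ (E.integral_pos θ).ne', ENNReal.ofReal_one]

lemma measurable_exp_inner (E : ExpFamily ν Θ d) : Measurable (fun p : Θ × X =>
    E.h p.2 * Real.exp (inner ℝ (E.η p.1) (E.T p.2))) :=
  (E.measurable_h.comp measurable_snd).mul (Real.measurable_exp.comp
    ((E.measurable_η.comp measurable_fst).inner (E.measurable_T.comp measurable_snd)))

section Sampling

variable [SigmaFinite ν]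

lemma measurable_density (E : ExpFamily ν Θ d) :
    Measurable (fun p : Θ × X => E.density p.1 p.2) := by
  have h1 : Measurable fun θ => E.normalizer (E.η θ) :=
    (E.measurable_exp_inner.stronglyMeasurable.integral_prod_right (ν := ν)).measurable.inv
  exact ((E.measurable_h.comp measurable_snd).mul (h1.comp measurable_fst)).mul
    (Real.measurable_exp.comp
      ((E.measurable_η.comp measurable_fst).inner (E.measurable_T.comp measurable_snd)))

lemma measurable_law (E : ExpFamily ν Θ d) : Measurable E.law := by
  refine Measure.measurable_of_measurable_coe _ fun s hs => ?_
  simp only [law, withDensity_apply _ hs]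
  exact E.measurable_density.ennreal_ofReal.lintegral_prod_right'

/-- The distribution `𝒟ⁿ` of a training set of `n` independent examples, as a Markov kernel from
parameters to training sets. -/
def sample (E : ExpFamily ν Θ d) (n : ℕ) : Kernel Θ (Fin n → X) where
  toFun θ := Measure.pi fun _ => E.law θ
  measurable' := by
    refine Measurable.measure_of_isPiSystem_of_isProbabilityMeasure generateFrom_pi.symm
      isPiSystem_pi ?_
    rintro _ ⟨s, hs, rfl⟩
    simp only [Measure.pi_pi]
    exact Finset.measurable_prod _ fun i _ =>
      (Measure.measurable_coe (hs i (Set.mem_univ i))).comp E.measurable_law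

instance isMarkovKernel_sample (E : ExpFamily ν Θ d) (n : ℕ) : IsMarkovKernel (E.sample n) :=
  ⟨fun θ => inferInstanceAs (IsProbabilityMeasure (Measure.pi fun _ : Fin n => E.law θ))⟩

end Sampling

/-- The density, with respect to Lebesgue measure on the natural parameter space, of the conjugate
prior with hyperparameters `n₀` and `τ₀`: `P(x) = Z₀⁻¹ g(x)^n₀ exp ⟨x, τ₀⟩`, where `Z₀` is the
integral of `g(x)^n₀ exp ⟨x, τ₀⟩` over the natural parameter space. -/
def priorDensity (E : ExpFamily ν Θ d) (n₀ : ℝ) (τ₀ x : EuclideanSpace ℝ (Fin d)) : ℝ :=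
  (∫ y in E.naturalSpace, E.normalizer y ^ n₀ * Real.exp (inner ℝ y τ₀))⁻¹ *
    (E.normalizer x ^ n₀ * Real.exp (inner ℝ x τ₀))

/-- `prior` is the conjugate prior with hyperparameters `n₀` and `τ₀`: this prior is proper, and
when the parameter `θ` has distribution `prior`, the natural parameter `η(θ)` has the density
`priorDensity` on the natural parameter space. -/
def IsConjugatePrior (E : ExpFamily ν Θ d) (n₀ : ℝ) (τ₀ : EuclideanSpace ℝ (Fin d))
    (prior : Measure Θ) : Prop :=
  IntegrableOn (fun x => E.normalizer x ^ n₀ * Real.exp (inner ℝ x τ₀)) E.naturalSpace ∧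
  prior.map E.η = (volume.restrict E.naturalSpace).withDensity
    (fun x => ENNReal.ofReal (E.priorDensity n₀ τ₀ x))

/-- Average training loss on the training set `Z`. -/
def trainLoss (E : ExpFamily ν Θ d) {n : ℕ} (Z : Fin n → X) (θ : Θ) : ℝ :=
  (1 / (n : ℝ)) * ∑ i, E.loss (Z i) θ

/-- Test loss of `θ` when examples are drawn from `P(· | t)`. -/
def testLoss (E : ExpFamily ν Θ d) (θ t : Θ) : ℝ := ∫ z, E.loss z θ ∂(E.law t)

/-- The expectation of `∫ f(z) P(dz | t)`, for `t` distributed according to `ρ`, exists and is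
finite. -/
def HasFiniteExpectation (E : ExpFamily ν Θ d) (ρ : Measure Θ) (f : X → ℝ) : Prop :=
  (∀ᵐ t ∂ρ, Integrable f (E.law t)) ∧ Integrable (fun t => ∫ z, f z ∂(E.law t)) ρ

/-- The regularizer `R*(θ) = - (1/n) log P(η(θ))`. -/
def regularizer (E : ExpFamily ν Θ d) (n₀ : ℝ) (τ₀ : EuclideanSpace ℝ (Fin d)) (n : ℕ)
    (θ : Θ) : ℝ :=
  - (1 / (n : ℝ)) * Real.log (E.priorDensity n₀ τ₀ (E.η θ))

variable [SigmaFinite ν] [StandardBorelSpace Θ] [Nonempty Θ]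

/-- The posterior distribution of the parameter, given the training set `Z`. -/
def posteriorLaw (E : ExpFamily ν Θ d) (prior : Measure Θ) [IsProbabilityMeasure prior] {n : ℕ}
    (Z : Fin n → X) : Measure Θ :=
  posterior (E.sample n) prior Z

/-- The conditional expectation of the test loss of `θ`, given the training set `Z`. -/
def expectedTestLoss (E : ExpFamily ν Θ d) (prior : Measure Θ) [IsProbabilityMeasure prior]
    {n : ℕ} (Z : Fin n → X) (θ : Θ) : ℝ :=
  ∫ t, E.testLoss θ t ∂(E.posteriorLaw prior Z)

end ExpFamily

end

/-!
The argument is conjugacy plus the linearity of the posterior mean of the sufficient statistic.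

Write `m = n + n₀` and `τ = τ₀ + ∑ T (Z i)`.  By Bayes' theorem for dominated kernels
(`posterior_eq_withDensity_div`) the posterior law of the natural parameter has a density
proportional to `w x = g x ^ m * exp ⟨x, τ⟩` on the natural parameter space `N`
(`ExpFamily.ae_map_posteriorLaw`).  Where `h` does not vanish,
`loss z θ = -log h z - log g (η θ) - ⟨η θ, T z⟩`, so the expected test loss is
`-H - log g (η θ) - ⟨η θ, M⟩`, where `H` is the posterior expectation of `log h` and `M` is the
posterior expectation of the mean `meanT x` of `T` at parameter `x`.  The regularized training loss
is `-(m / n) log g (η θ) - ⟨η θ, τ⟩ / n` up to a constant.  The two are related by the claimed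
increasing affine map as soon as `M = τ / m` (`ExpFamily.integral_conjugateWeight_mul_meanT`).

Since `meanT` is the gradient of the log-partition function `-log g`, the gradient of `w` is
`w x • (τ - m • meanT x)`, and `M = τ / m` says that this gradient has integral zero.  That is a
divergence theorem for integrable log-concave densities which vanish at the boundary of `N`
(`IsLogConcaveWithGradient.integral_inner_eq_zero`); `w` vanishes there by Fatou's lemma, because
`N` is open.  Two points need care.

* The gradient is integrable.  If `f = log w ≥ M` on a ball of radius `r` around `x₀`, concavity
  gives `(r / 2) ‖∇f x‖ ≤ f x - M - ⟨∇f x, x - x₀⟩`.  Here `f` is bounded above, and the integral of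
  the radial derivative of `w` is controlled by Fatou's lemma for the difference quotients along
  contractions towards `x₀`, which scale volumes by an explicit factor.
* `w` need not be differentiable at the boundary of `N`.  Integration by parts is applied to
  `cutoff ε ∘ w`, which is differentiable everywhere, and then `ε → 0`.
-/

noncomputable section

/-! ### A divergence theorem for log-concave densities -/

section LogConcave

open Filter Topology

variable {V : Type*} [NormedAddCommGroup V] [InnerProductSpace ℝ V]

/-- `f` is concave on the convex open set `N` with gradient field `D`, and `exp ∘ f`, extended by
zero, vanishes continuously at every point outside `N`.  The gradient is encoded by its line
derivatives and by the supergradient inequality, and no Fréchet derivative is asked for. -/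
structure IsLogConcaveWithGradient (N : Set V) (f : V → ℝ) (D : V → V) : Prop where
  isOpen : IsOpen N
  convex : Convex ℝ N
  le_add_inner : ∀ x ∈ N, ∀ y ∈ N, f y ≤ f x + inner ℝ (D x) (y - x)
  hasLineDerivAt : ∀ x ∈ N, ∀ v, HasLineDerivAt ℝ f (inner ℝ (D x) v) x v
  tendsto_zero : ∀ x ∉ N, Tendsto (N.indicator fun y => Real.exp (f y)) (𝓝 x) (𝓝 0)

/-- A `C¹` truncation of the identity near zero: `(u - ε)² / u` above `ε` and `0` below. -/
def cutoff (ε u : ℝ) : ℝ := if u ≤ ε then 0 else (u - ε) ^ 2 / u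

/-- The derivative of `cutoff ε`. -/
def cutoffDeriv (ε u : ℝ) : ℝ := if u ≤ ε then 0 else 1 - (ε / u) ^ 2

lemma hasDerivAt_cutoff {ε : ℝ} (hε : 0 < ε) (u : ℝ) :
    HasDerivAt (cutoff ε) (cutoffDeriv ε u) u := by
  have key : ∀ u, ε ≤ u → HasDerivAt (fun u : ℝ => (u - ε) ^ 2 / u) (1 - (ε / u) ^ 2) u := by
    intro u hu
    have hu0 : u ≠ 0 := (hε.trans_le hu).ne'
    have h1 : HasDerivAt (fun u : ℝ => (u - ε) ^ 2) (2 * (u - ε)) u := by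
      simpa using ((hasDerivAt_id u).sub_const ε).fun_pow 2
    refine (h1.div (hasDerivAt_id' u) hu0).congr_deriv ?_
    field_simp
    ring
  rcases lt_trichotomy u ε with h | h | h
  · have : cutoff ε =ᶠ[𝓝 u] fun _ => 0 := by
      filter_upwards [Iio_mem_nhds h] with y hy
      simp [cutoff, (Set.mem_Iio.1 hy).le]
    simpa [cutoffDeriv, h.le] using (hasDerivAt_const u (0 : ℝ)).congr_of_eventuallyEq this
  · subst h
    have h1 : HasDerivWithinAt (cutoff u) 0 (Set.Iic u) u := by
      refine (hasDerivWithinAt_const u (Set.Iic u) (0 : ℝ)).congr ?_ ?_ <;>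
        simp +contextual [cutoff]
    have h2 : HasDerivWithinAt (cutoff u) 0 (Set.Ici u) u := by
      have h3 : HasDerivWithinAt (fun y : ℝ => (y - u) ^ 2 / y) 0 (Set.Ici u) u := by
        have := (key u le_rfl).hasDerivWithinAt (s := Set.Ici u)
        simpa [div_self hε.ne'] using this
      refine h3.congr (fun y hy => ?_) ?_
      · rcases (Set.mem_Ici.1 hy).eq_or_lt with rfl | hy'
        · simp [cutoff]
        · simp [cutoff, hy'.not_ge]
      · simp [cutoff]
    have := h1.union h2
    rw [Set.Iic_union_Ici, hasDerivWithinAt_univ] at this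
    simpa [cutoffDeriv] using this
  · have : cutoff ε =ᶠ[𝓝 u] fun u => (u - ε) ^ 2 / u := by
      filter_upwards [Ioi_mem_nhds h] with y hy
      simp [cutoff, (Set.mem_Ioi.1 hy).not_ge]
    simpa [cutoffDeriv, h.not_ge] using (key u h.le).congr_of_eventuallyEq this

lemma measurable_cutoff (ε : ℝ) : Measurable (cutoff ε) :=
  Measurable.ite measurableSet_Iic measurable_const (by fun_prop)

lemma measurable_cutoffDeriv (ε : ℝ) : Measurable (cutoffDeriv ε) :=
  Measurable.ite measurableSet_Iic measurable_const (by fun_prop)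

lemma abs_cutoff_le {ε u : ℝ} (hε : 0 < ε) (hu : 0 ≤ u) : |cutoff ε u| ≤ u := by
  unfold cutoff
  split_ifs with h
  · simpa using hu
  · push Not at h
    have : 0 < u := hε.trans h
    rw [abs_of_nonneg (by positivity), div_le_iff₀ this]
    nlinarith

lemma abs_cutoffDeriv_le {ε u : ℝ} (hε : 0 < ε) : |cutoffDeriv ε u| ≤ 1 := by
  unfold cutoffDeriv
  split_ifs with h
  · simp
  · push Not at h
    have h1 : ε / u ≤ 1 := (div_le_one (hε.trans h)).2 h.le
    have h2 : 0 ≤ ε / u := div_nonneg hε.le (hε.trans h).le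
    rw [abs_le]
    constructor <;> nlinarith

lemma tendsto_cutoffDeriv {u : ℝ} (hu : 0 < u) :
    Tendsto (fun ε => cutoffDeriv ε u) (𝓝[>] 0) (𝓝 1) := by
  have h1 : Tendsto (fun ε : ℝ => 1 - (ε / u) ^ 2) (𝓝[>] 0) (𝓝 1) := by
    have : Continuous fun ε : ℝ => 1 - (ε / u) ^ 2 := by fun_prop
    simpa using (this.tendsto 0).mono_left nhdsWithin_le_nhds
  refine h1.congr' ?_
  filter_upwards [nhdsWithin_le_nhds (Iio_mem_nhds hu)] with ε hε
  simp [cutoffDeriv, (Set.mem_Iio.1 hε).not_ge]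

namespace IsLogConcaveWithGradient

variable {N : Set V} {f : V → ℝ} {D : V → V}

lemma concaveOn (h : IsLogConcaveWithGradient N f D) : ConcaveOn ℝ N f := by
  refine ⟨h.convex, fun x hx y hy a b ha hb hab => ?_⟩
  have hz := h.convex hx hy ha hb hab
  set z := a • x + b • y with hzdef
  have h1 := mul_le_mul_of_nonneg_left (h.le_add_inner z hz x hx) ha
  have h2 := mul_le_mul_of_nonneg_left (h.le_add_inner z hz y hy) hb
  have h3 : a * inner ℝ (D z) (x - z) + b * inner ℝ (D z) (y - z) = 0 := by
    rw [← real_inner_smul_right, ← real_inner_smul_right, ← inner_add_right]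
    have : a • (x - z) + b • (y - z) = 0 := by
      rw [smul_sub, smul_sub, sub_add_sub_comm, ← hzdef, ← add_smul, hab, one_smul, sub_self]
    rw [this, inner_zero_right]
  simp only [smul_eq_mul]
  have h4 : (a + b) * f z = f z := by rw [hab, one_mul]
  nlinarith

lemma hasLineDerivAt_indicator (h : IsLogConcaveWithGradient N f D) {x : V} (hx : x ∈ N) (v : V) :
    HasLineDerivAt ℝ (N.indicator fun y => Real.exp (f y))
      (N.indicator (fun y => Real.exp (f y)) x * inner ℝ (D x) v) x v := by
  have h1 : HasLineDerivAt ℝ (fun y => Real.exp (f y)) (Real.exp (f x) * inner ℝ (D x) v) x v := by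
    have := HasDerivAt.exp (h.hasLineDerivAt x hx v)
    simpa [HasLineDerivAt] using this
  rw [Set.indicator_of_mem hx]
  refine h1.congr_of_eventuallyEq ?_
  filter_upwards [h.isOpen.mem_nhds hx] with y hy
  rw [Set.indicator_of_mem hy]

omit [NormedAddCommGroup V] [InnerProductSpace ℝ V] in
lemma indicator_nonneg (x : V) : 0 ≤ N.indicator (fun y => Real.exp (f y)) x :=
  Set.indicator_nonneg (fun _ _ => (Real.exp_pos _).le) x

/-- The truncated density is line differentiable everywhere, although the density itself may fail
to be so on the boundary of `N`. -/
lemma hasLineDerivAt_cutoff (h : IsLogConcaveWithGradient N f D) {ε : ℝ} (hε : 0 < ε)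
    (x v : V) :
    HasLineDerivAt ℝ (fun y => cutoff ε (N.indicator (fun y => Real.exp (f y)) y))
      (cutoffDeriv ε (N.indicator (fun y => Real.exp (f y)) x) *
        (N.indicator (fun y => Real.exp (f y)) x * inner ℝ (D x) v)) x v := by
  by_cases hx : x ∈ N
  · have h1 := h.hasLineDerivAt_indicator hx v
    have h2 : HasDerivAt (cutoff ε) (cutoffDeriv ε
        (N.indicator (fun y => Real.exp (f y)) x))
        (N.indicator (fun y => Real.exp (f y)) (x + (0 : ℝ) • v)) := by
      simpa using hasDerivAt_cutoff hε (N.indicator (fun y => Real.exp (f y)) x)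
    exact HasDerivAt.comp (h₂ := cutoff ε)
      (h := fun t : ℝ => N.indicator (fun y => Real.exp (f y)) (x + t • v)) (0 : ℝ) h2 h1
  · have h0 : N.indicator (fun y => Real.exp (f y)) x = 0 := Set.indicator_of_notMem hx _
    have h1 : (fun y => cutoff ε (N.indicator (fun y => Real.exp (f y)) y)) =ᶠ[𝓝 x]
        fun _ => 0 := by
      filter_upwards [(h.tendsto_zero x hx).eventually (Iio_mem_nhds hε)] with y hy
      simp [cutoff, (show _ < ε from hy).le]
    rw [h0, zero_mul, mul_zero]
    refine HasLineDerivAt.congr_of_eventuallyEq ?_ h1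
    simpa [HasLineDerivAt] using hasDerivAt_const (0 : ℝ) (0 : ℝ)

variable [FiniteDimensional ℝ V]

/-- Near `x₀` the concave function `f` is bounded below by some `M`; evaluating the supergradient
inequality at the point of the ball opposite to `D x` bounds the gradient everywhere by the radial
derivative. -/
lemma exists_mul_norm_le (h : IsLogConcaveWithGradient N f D) {x₀ : V} (hx₀ : x₀ ∈ N) :
    ∃ r > 0, ∃ M : ℝ, (∀ y ∈ Metric.ball x₀ r, y ∈ N ∧ M ≤ f y) ∧
      ∀ x ∈ N, r / 2 * ‖D x‖ ≤ f x - M - inner ℝ (D x) (x - x₀) := by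
  have hc : ContinuousAt f x₀ :=
    (h.concaveOn.continuousOn h.isOpen).continuousAt (h.isOpen.mem_nhds hx₀)
  have h1 : ∀ᶠ y in 𝓝 x₀, y ∈ N ∧ f x₀ - 1 ≤ f y :=
    (show ∀ᶠ y in 𝓝 x₀, y ∈ N from h.isOpen.mem_nhds hx₀).and
      ((hc.eventually (Ioi_mem_nhds (sub_one_lt (f x₀)))).mono fun y hy => (Set.mem_Ioi.1 hy).le)
  obtain ⟨r, hr, hball⟩ := Metric.eventually_nhds_iff_ball.1 h1
  refine ⟨r, hr, f x₀ - 1, hball, fun x hx => ?_⟩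
  by_cases hD : D x = 0
  · have := h.le_add_inner x hx x₀ hx₀
    simp only [hD, inner_zero_left, norm_zero] at this ⊢
    linarith
  · have hD' : 0 < ‖D x‖ := norm_pos_iff.2 hD
    set y := x₀ - (r / 2 / ‖D x‖) • D x with hy
    have hyb : y ∈ Metric.ball x₀ r := by
      rw [Metric.mem_ball, dist_eq_norm, hy, sub_sub_cancel_left, norm_neg, norm_smul,
        Real.norm_of_nonneg (by positivity), div_mul_cancel₀ _ hD'.ne']
      linarith
    obtain ⟨hyN, hyM⟩ := hball y hyb
    have h2 := h.le_add_inner x hx y hyN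
    have h3 : inner ℝ (D x) (y - x) = - inner ℝ (D x) (x - x₀) - r / 2 * ‖D x‖ := by
      have : y - x = -(x - x₀) - (r / 2 / ‖D x‖) • D x := by rw [hy]; abel
      rw [this, inner_sub_right, inner_neg_right, inner_smul_right, real_inner_self_eq_norm_sq]
      field_simp
    linarith

variable [MeasurableSpace V] [BorelSpace V] {μ : Measure V} [μ.IsAddHaarMeasure]

/-- An integrable log-concave function is bounded: halfway between `x` and a fixed ball in `N`
lies a ball of half the radius, on which the function is at least of order `exp (f x / 2)`. -/
lemma exists_le (h : IsLogConcaveWithGradient N f D)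
    (hint : Integrable (N.indicator fun y => Real.exp (f y)) μ) {x₀ : V} (hx₀ : x₀ ∈ N) :
    ∃ C : ℝ, ∀ x ∈ N, f x ≤ C := by
  obtain ⟨r, hr, M, hball, -⟩ := h.exists_mul_norm_le hx₀
  set I := ∫ y, N.indicator (fun y => Real.exp (f y)) y ∂μ
  set β := μ.real (Metric.ball (0 : V) (r / 2))
  have hβ : 0 < β := ENNReal.toReal_pos
    (Metric.measure_ball_pos μ _ (by positivity)).ne' measure_ball_lt_top.ne
  refine ⟨2 * Real.log (I / β) - M, fun x hx => ?_⟩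
  have hsub : Metric.ball ((1 / 2 : ℝ) • x + (1 / 2 : ℝ) • x₀) (r / 2) ⊆
      {w | Real.exp ((f x + M) / 2) ≤ N.indicator (fun y => Real.exp (f y)) w} := by
    intro w hw
    have hy : (2 : ℝ) • w - x ∈ Metric.ball x₀ r := by
      rw [Metric.mem_ball, dist_eq_norm] at hw ⊢
      have : (2 : ℝ) • w - x - x₀ = (2 : ℝ) • (w - ((1 / 2 : ℝ) • x + (1 / 2 : ℝ) • x₀)) := by
        module
      rw [this, norm_smul, Real.norm_of_nonneg zero_le_two]
      linarith
    obtain ⟨hyN, hyM⟩ := hball _ hy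
    have hw' : w = (1 / 2 : ℝ) • x + (1 / 2 : ℝ) • ((2 : ℝ) • w - x) := by module
    have hwN : w ∈ N := by
      rw [hw']
      exact h.convex hx hyN (by norm_num) (by norm_num) (by norm_num)
    have hconc := h.concaveOn.2 hx hyN (by norm_num : (0 : ℝ) ≤ 1 / 2)
      (by norm_num : (0 : ℝ) ≤ 1 / 2) (by norm_num)
    rw [← hw'] at hconc
    simp only [smul_eq_mul] at hconc
    rw [Set.mem_ofPred_eq, Set.indicator_of_mem hwN]
    exact Real.exp_le_exp.2 (by linarith)
  have hmarkov := mul_meas_ge_le_integral_of_nonneg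
    (Eventually.of_forall (indicator_nonneg (N := N) (f := f))) hint (Real.exp ((f x + M) / 2))
  have hmeas : β ≤ μ.real {w | Real.exp ((f x + M) / 2) ≤
      N.indicator (fun y => Real.exp (f y)) w} := by
    have hfin : μ {w | Real.exp ((f x + M) / 2) ≤
        N.indicator (fun y => Real.exp (f y)) w} ≠ ⊤ :=
      (hint.measure_ge_lt_top (Real.exp_pos _)).ne
    refine le_trans (le_of_eq ?_) (measureReal_mono hsub hfin)
    simp only [β, measureReal_def, Measure.addHaar_ball_center]
  have h1 : Real.exp ((f x + M) / 2) ≤ I / β := by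
    rw [le_div_iff₀ hβ]
    exact (mul_le_mul_of_nonneg_left hmeas (Real.exp_pos _).le).trans hmarkov
  have h2 := Real.log_le_log (Real.exp_pos _) h1
  rw [Real.log_exp] at h2
  linarith

/-- The difference quotients of the density under the contraction `x ↦ x + s (x₀ - x)` have
uniformly bounded integrals, because the contraction scales volumes by `(1 - s) ^ d`. -/
lemma integral_contraction_sub_le
    (hint : Integrable (N.indicator fun y => Real.exp (f y)) μ) (x₀ : V) {s : ℝ} (hs : 0 < s)
    (hs' : s ≤ 1 / 2) :
    Integrable (fun x => N.indicator (fun y => Real.exp (f y)) (x + s • (x₀ - x))) μ ∧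
    ∫ x, s⁻¹ * (N.indicator (fun y => Real.exp (f y)) (x + s • (x₀ - x)) -
        N.indicator (fun y => Real.exp (f y)) x) ∂μ ≤
      Module.finrank ℝ V * 2 ^ Module.finrank ℝ V *
        ∫ x, N.indicator (fun y => Real.exp (f y)) x ∂μ := by
  set p := N.indicator (fun y => Real.exp (f y)) with hp
  set d := Module.finrank ℝ V
  have hI : 0 ≤ ∫ x, p x ∂μ := integral_nonneg indicator_nonneg
  have heq : (fun x => p (x + s • (x₀ - x))) = fun x => p ((1 - s) • x + s • x₀) := by
    funext x; congr 1; module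
  have h1s : 0 < 1 - s := by linarith
  have hint' : Integrable (fun x => p ((1 - s) • x + s • x₀)) μ :=
    (hint.comp_add_right (s • x₀)).comp_smul h1s.ne'
  have hval : ∫ x, p ((1 - s) • x + s • x₀) ∂μ = ((1 - s) ^ d)⁻¹ * ∫ x, p x ∂μ := by
    rw [Measure.integral_comp_smul μ (fun x => p (x + s • x₀)) (1 - s),
      integral_add_right_eq_self (fun x => p x), abs_of_pos (by positivity), smul_eq_mul]
  refine ⟨heq ▸ hint', ?_⟩
  have heq' := fun x => congrFun heq x
  simp only [heq']
  rw [integral_const_mul, integral_sub hint' hint, hval]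
  have hb : 1 - d * s ≤ (1 - s) ^ d := by
    have := one_add_mul_le_pow (a := -s) (by linarith) d
    rw [sub_eq_add_neg 1 s]
    linarith
  have hc : (1 / 2 : ℝ) ^ d ≤ (1 - s) ^ d := pow_le_pow_left₀ (by norm_num) (by linarith) d
  have hc' : ((1 - s) ^ d)⁻¹ ≤ 2 ^ d := by
    calc ((1 - s) ^ d)⁻¹ ≤ ((1 / 2 : ℝ) ^ d)⁻¹ := inv_anti₀ (by positivity) hc
      _ = 2 ^ d := by rw [one_div, inv_pow, inv_inv]
  have hpos : 0 < (1 - s) ^ d := by positivity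
  have hquot : s⁻¹ * (((1 - s) ^ d)⁻¹ - 1) ≤ d * 2 ^ d := by
    calc s⁻¹ * (((1 - s) ^ d)⁻¹ - 1) = s⁻¹ * ((1 - (1 - s) ^ d) * ((1 - s) ^ d)⁻¹) := by
          rw [sub_mul, mul_inv_cancel₀ hpos.ne', one_mul]
      _ ≤ s⁻¹ * ((d * s) * 2 ^ d) := by
          gcongr
          linarith
      _ = d * 2 ^ d := by field_simp
  calc s⁻¹ * (((1 - s) ^ d)⁻¹ * ∫ x, p x ∂μ - ∫ x, p x ∂μ)
      = (s⁻¹ * (((1 - s) ^ d)⁻¹ - 1)) * ∫ x, p x ∂μ := by ring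
    _ ≤ d * 2 ^ d * ∫ x, p x ∂μ := mul_le_mul_of_nonneg_right hquot hI

/-- The radial derivative of an integrable log-concave density is integrable, by Fatou's lemma along
contractions towards `x₀`. -/
lemma integrableOn_radial (h : IsLogConcaveWithGradient N f D)
    (hint : Integrable (N.indicator fun y => Real.exp (f y)) μ) {x₀ : V} (hx₀ : x₀ ∈ N) :
    IntegrableOn (fun x => Real.exp (f x) * inner ℝ (D x) (x - x₀)) N μ := by
  obtain ⟨C, hC⟩ := h.exists_le hint hx₀
  set p := N.indicator (fun y => Real.exp (f y)) with hp
  have hp0 : ∀ x, 0 ≤ p x := indicator_nonneg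
  have hpN : ∀ x ∈ N, p x = Real.exp (f x) := fun x hx => Set.indicator_of_mem hx _
  set s : ℕ → ℝ := fun k => 1 / ((k : ℝ) + 2)
  have hs0 : ∀ k, 0 < s k := fun k => by positivity
  have hs1 : ∀ k, s k ≤ 1 / 2 := fun k => by
    apply one_div_le_one_div_of_le two_pos
    have : (0 : ℝ) ≤ k := k.cast_nonneg
    linarith
  have hslim : Tendsto s atTop (𝓝[>] 0) := by
    refine tendsto_nhdsWithin_iff.2 ⟨?_, Eventually.of_forall hs0⟩
    have h1 : Tendsto (fun k : ℕ => (k : ℝ) + 2) atTop atTop :=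
      tendsto_atTop_add_const_right _ _ tendsto_natCast_atTop_atTop
    simpa [s, Pi.inv_def] using h1.inv_tendsto_atTop
  set q : ℕ → V → ℝ := fun k x => (s k)⁻¹ * (p (x + s k • (x₀ - x)) - p x) + (C - f x₀) * p x
    with hq
  have hcontr := fun k => integral_contraction_sub_le (μ := μ) hint x₀ (hs0 k) (hs1 k)
  have hqint : ∀ k, Integrable (q k) μ := fun k =>
    (((hcontr k).1.sub hint).const_mul _).add (hint.const_mul _)
  -- Concavity along the segment from `x` to `x₀` makes the corrected quotient nonnegative.
  have hqnonneg : ∀ k x, 0 ≤ q k x := by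
    intro k x
    by_cases hx : x ∈ N
    · have hmem : x + s k • (x₀ - x) ∈ N := h.convex.add_smul_sub_mem hx hx₀
        ⟨(hs0 k).le, (hs1 k).trans (by norm_num)⟩
      have hconc := h.concaveOn.2 hx hx₀ (by linarith [hs1 k] : 0 ≤ 1 - s k)
        (hs0 k).le (by ring)
      have he : (1 - s k) • x + s k • x₀ = x + s k • (x₀ - x) := by module
      rw [he] at hconc
      simp only [smul_eq_mul] at hconc
      simp only [hq, hpN x hx, hpN _ hmem]
      have h1 : Real.exp (f x) * (1 + s k * (f x₀ - f x)) ≤ Real.exp (f (x + s k • (x₀ - x))) := by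
        calc Real.exp (f x) * (1 + s k * (f x₀ - f x))
            ≤ Real.exp (f x) * Real.exp (s k * (f x₀ - f x)) := by
              gcongr
              linarith [Real.add_one_le_exp (s k * (f x₀ - f x))]
          _ = Real.exp (f x + s k * (f x₀ - f x)) := (Real.exp_add _ _).symm
          _ ≤ _ := Real.exp_le_exp.2 (by linarith)
      have h2 : Real.exp (f x) * (f x₀ - f x) ≤
          (s k)⁻¹ * (Real.exp (f (x + s k • (x₀ - x))) - Real.exp (f x)) := by
        rw [inv_mul_eq_div, le_div_iff₀ (hs0 k)]
        linarith
      have h3 : Real.exp (f x) * (f x) ≤ Real.exp (f x) * C :=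
        mul_le_mul_of_nonneg_left (hC x hx) (Real.exp_pos _).le
      linarith
    · have : p x = 0 := Set.indicator_of_notMem hx _
      simp only [hq, this]
      have := mul_nonneg (inv_nonneg.2 (hs0 k).le) (hp0 (x + s k • (x₀ - x)))
      linarith
  have hqlim : ∀ x ∈ N, Tendsto (fun k => q k x) atTop
      (𝓝 (p x * inner ℝ (D x) (x₀ - x) + (C - f x₀) * p x)) := by
    intro x hx
    refine Tendsto.add_const _ ?_
    have h1 := hasDerivAt_iff_tendsto_slope_zero.1 (h.hasLineDerivAt_indicator hx (x₀ - x))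
    have h2 := h1.comp (hslim.mono_right (nhdsWithin_mono _ fun y hy => (ne_of_gt hy : y ≠ 0)))
    simpa [Function.comp_def] using h2
  have hlimint : Integrable (fun x => p x * inner ℝ (D x) (x₀ - x) + (C - f x₀) * p x)
      (μ.restrict N) := by
    have hlim : ∀ᵐ x ∂μ.restrict N, Tendsto (fun k => q k x) atTop
        (𝓝 (p x * inner ℝ (D x) (x₀ - x) + (C - f x₀) * p x)) :=
      (ae_restrict_iff' h.isOpen.measurableSet).2 (Eventually.of_forall hqlim)
    have hmeas : ∀ k, AEStronglyMeasurable (q k) (μ.restrict N) := fun k =>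
      (hqint k).1.restrict
    refine ⟨aestronglyMeasurable_of_tendsto_ae _ hmeas hlim, ?_⟩
    have hfatou : ∫⁻ x in N, ‖p x * inner ℝ (D x) (x₀ - x) + (C - f x₀) * p x‖ₑ ∂μ ≤
        liminf (fun k => ∫⁻ x in N, ‖q k x‖ₑ ∂μ) atTop := by
      refine (lintegral_congr_ae ?_).trans_le
        (lintegral_liminf_le' fun k => (hmeas k).aemeasurable.enorm)
      filter_upwards [hlim] with x hx
      exact hx.enorm.liminf_eq.symm
    refine hfatou.trans_lt ?_
    set B := ENNReal.ofReal (Module.finrank ℝ V * 2 ^ Module.finrank ℝ V * ∫ x, p x ∂μ +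
      (C - f x₀) * ∫ x, p x ∂μ)
    refine lt_of_le_of_lt (b := B) (liminf_le_of_le (by isBoundedDefault) fun b hb => ?_)
      ENNReal.ofReal_lt_top
    obtain ⟨k, hk⟩ := hb.exists
    refine hk.trans ((lintegral_mono' Measure.restrict_le_self le_rfl).trans ?_)
    have hnorm : ∀ x, ‖q k x‖ₑ = ENNReal.ofReal (q k x) := fun x =>
      Real.enorm_of_nonneg (hqnonneg k x)
    simp only [hnorm]
    rw [← ofReal_integral_eq_lintegral_ofReal (hqint k) (Eventually.of_forall (hqnonneg k))]
    refine ENNReal.ofReal_le_ofReal ?_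
    simp only [hq]
    have hquot : Integrable (fun x => (s k)⁻¹ * (p (x + s k • (x₀ - x)) - p x)) μ :=
      ((hcontr k).1.sub hint).const_mul _
    rw [integral_add hquot (hint.const_mul _), integral_const_mul (C - f x₀)]
    exact add_le_add_left (hcontr k).2 _
  have hfinal := ((hint.const_mul (C - f x₀)).restrict (s := N)).sub hlimint
  refine hfinal.congr ((ae_restrict_iff' h.isOpen.measurableSet).2
    (Eventually.of_forall fun x hx => ?_))
  have : inner ℝ (D x) (x - x₀) = - inner ℝ (D x) (x₀ - x) := by
    rw [← inner_neg_right, neg_sub]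
  simp only [Pi.sub_apply, this, hpN x hx]
  ring

/-- The gradient of an integrable log-concave density is integrable. -/
lemma integrableOn_norm (h : IsLogConcaveWithGradient N f D)
    (hD : AEStronglyMeasurable D (μ.restrict N))
    (hint : Integrable (N.indicator fun y => Real.exp (f y)) μ) :
    IntegrableOn (fun x => Real.exp (f x) * ‖D x‖) N μ := by
  rcases N.eq_empty_or_nonempty with rfl | ⟨x₀, hx₀⟩
  · simp
  obtain ⟨C, hC⟩ := h.exists_le hint hx₀
  obtain ⟨r, hr, M, -, hM⟩ := h.exists_mul_norm_le hx₀
  have hexp : IntegrableOn (fun x => Real.exp (f x)) N μ :=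
    (integrable_indicator_iff h.isOpen.measurableSet).1 hint
  have hdom := ((hexp.const_mul (C - M)).sub (h.integrableOn_radial hint hx₀)).const_mul (2 / r)
  refine Integrable.mono' hdom (hexp.1.mul hD.norm) ((ae_restrict_iff' h.isOpen.measurableSet).2
    (Eventually.of_forall fun x hx => ?_))
  rw [Real.norm_of_nonneg (by positivity)]
  have h1 := hM x hx
  have h2 := hC x hx
  have h3 : ‖D x‖ ≤ 2 / r * (C - M - inner ℝ (D x) (x - x₀)) := by
    rw [div_mul_eq_mul_div, le_div_iff₀ hr]
    linarith
  calc Real.exp (f x) * ‖D x‖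
      ≤ Real.exp (f x) * (2 / r * (C - M - inner ℝ (D x) (x - x₀))) := by gcongr
    _ = _ := by simp only [Pi.sub_apply]; ring

/-- **Divergence theorem for log-concave densities.**  The integral of every directional derivative
vanishes: there is no boundary term, since the density vanishes on the boundary of `N`. -/
theorem integral_inner_eq_zero (h : IsLogConcaveWithGradient N f D)
    (hD : AEStronglyMeasurable D (μ.restrict N))
    (hint : Integrable (N.indicator fun y => Real.exp (f y)) μ) (v : V) :
    IntegrableOn (fun x => Real.exp (f x) * inner ℝ (D x) v) N μ ∧
      ∫ x in N, Real.exp (f x) * inner ℝ (D x) v ∂μ = 0 := by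
  have hN := h.isOpen.measurableSet
  have hexp : IntegrableOn (fun x => Real.exp (f x)) N μ :=
    (integrable_indicator_iff hN).1 hint
  have hmain : IntegrableOn (fun x => Real.exp (f x) * inner ℝ (D x) v) N μ := by
    refine Integrable.mono' ((h.integrableOn_norm hD hint).mul_const ‖v‖)
      (hexp.1.mul (hD.inner aestronglyMeasurable_const)) (Eventually.of_forall fun x => ?_)
    rw [norm_mul, Real.norm_of_nonneg (Real.exp_pos _).le, mul_assoc]
    exact mul_le_mul_of_nonneg_left (norm_inner_le_norm _ _) (Real.exp_pos _).le
  refine ⟨hmain, ?_⟩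
  set p := N.indicator (fun y => Real.exp (f y)) with hp
  have hp0 : ∀ x, 0 ≤ p x := indicator_nonneg
  have hind : (fun x => p x * inner ℝ (D x) v) =
      N.indicator fun x => Real.exp (f x) * inner ℝ (D x) v := by
    funext x
    by_cases hx : x ∈ N <;> simp [hp, hx]
  have hpD : Integrable (fun x => p x * inner ℝ (D x) v) μ := by
    rw [hind]; exact (integrable_indicator_iff hN).2 hmain
  have hzero : ∀ ε > 0, ∫ x, cutoffDeriv ε (p x) * (p x * inner ℝ (D x) v) ∂μ = 0 := by
    intro ε hε
    have hderiv : Integrable (fun x => cutoffDeriv ε (p x) * (p x * inner ℝ (D x) v)) μ :=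
      hpD.bdd_mul (c := 1)
        ((measurable_cutoffDeriv ε).comp_aemeasurable hint.1.aemeasurable).aestronglyMeasurable
        (Eventually.of_forall fun x => abs_cutoffDeriv_le hε)
    have hcut : Integrable (fun x => cutoff ε (p x)) μ := by
      refine Integrable.mono' hint
        ((measurable_cutoff ε).comp_aemeasurable hint.1.aemeasurable).aestronglyMeasurable
        (Eventually.of_forall fun x => ?_)
      exact abs_cutoff_le hε (hp0 x)
    have := integral_bilinear_hasLineDerivAt_right_eq_neg_left_of_integrable (μ := μ)
      (f := fun _ : V => (1 : ℝ)) (f' := fun _ => (0 : ℝ)) (g := fun x => cutoff ε (p x))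
      (g' := fun x => cutoffDeriv ε (p x) * (p x * inner ℝ (D x) v)) (v := v)
      (B := ContinuousLinearMap.mul ℝ ℝ) (by simp) (by simpa using hderiv) (by simpa using hcut)
      (fun x _ => by simpa [HasLineDerivAt] using hasDerivAt_const (0 : ℝ) (1 : ℝ))
      (fun x _ => h.hasLineDerivAt_cutoff hε x v)
    simpa using this
  have hlim : Tendsto (fun ε => ∫ x, cutoffDeriv ε (p x) * (p x * inner ℝ (D x) v) ∂μ) (𝓝[>] 0)
      (𝓝 (∫ x, p x * inner ℝ (D x) v ∂μ)) := by
    refine tendsto_integral_filter_of_dominated_convergence (fun x => ‖p x * inner ℝ (D x) v‖)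
      (Eventually.of_forall fun ε => ?_) ?_ hpD.norm (Eventually.of_forall fun x => ?_)
    · exact ((measurable_cutoffDeriv ε).comp_aemeasurable
        hint.1.aemeasurable).aestronglyMeasurable.mul hpD.1
    · filter_upwards [self_mem_nhdsWithin] with ε hε
      refine Eventually.of_forall fun x => ?_
      rw [norm_mul]
      exact mul_le_of_le_one_left (norm_nonneg _) (abs_cutoffDeriv_le hε)
    · rcases (hp0 x).eq_or_lt with h0 | h0
      · simp [← h0]
      · simpa using (tendsto_cutoffDeriv h0).mul_const (p x * inner ℝ (D x) v)
  have hlim0 : Tendsto (fun ε => ∫ x, cutoffDeriv ε (p x) * (p x * inner ℝ (D x) v) ∂μ) (𝓝[>] 0)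
      (𝓝 0) :=
    tendsto_const_nhds.congr' (by
      filter_upwards [self_mem_nhdsWithin] with ε hε
      exact (hzero ε hε).symm)
  have := tendsto_nhds_unique hlim hlim0
  rwa [hind, integral_indicator hN] at this

end IsLogConcaveWithGradient

end LogConcave

/-! ### The log-partition function and the conjugate density -/

namespace ExpFamily

open Filter Topology

variable {X : Type*} [MeasurableSpace X] {ν : Measure X}
  {Θ : Type*} [MeasurableSpace Θ] {d : ℕ}

/-- The unnormalised density with natural parameter `x`. -/
def weight (E : ExpFamily ν Θ d) (x : EuclideanSpace ℝ (Fin d)) (z : X) : ℝ :=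
  E.h z * Real.exp (inner ℝ x (E.T z))

/-- The partition function, the reciprocal of `normalizer`. -/
def partition (E : ExpFamily ν Θ d) (x : EuclideanSpace ℝ (Fin d)) : ℝ := ∫ z, E.weight x z ∂ν

/-- The mean of the sufficient statistic at the natural parameter `x`. -/
def meanT (E : ExpFamily ν Θ d) (x : EuclideanSpace ℝ (Fin d)) : EuclideanSpace ℝ (Fin d) :=
  E.normalizer x • ∫ z, E.weight x z • E.T z ∂ν

lemma normalizer_eq_inv_partition (E : ExpFamily ν Θ d) (x : EuclideanSpace ℝ (Fin d)) :
    E.normalizer x = (E.partition x)⁻¹ := rfl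

lemma integrable_weight (E : ExpFamily ν Θ d) {x : EuclideanSpace ℝ (Fin d)}
    (hx : x ∈ E.naturalSpace) : Integrable (E.weight x) ν := hx

lemma weight_nonneg (E : ExpFamily ν Θ d) (x : EuclideanSpace ℝ (Fin d)) (z : X) :
    0 ≤ E.weight x z := mul_nonneg (E.h_nonneg z) (Real.exp_pos _).le

lemma measurable_weight (E : ExpFamily ν Θ d) (x : EuclideanSpace ℝ (Fin d)) :
    Measurable (E.weight x) :=
  E.measurable_h.mul (Real.measurable_exp.comp (measurable_const.inner E.measurable_T))

lemma weight_add (E : ExpFamily ν Θ d) (x y : EuclideanSpace ℝ (Fin d)) (z : X) :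
    E.weight (x + y) z = E.weight x z * Real.exp (inner ℝ y (E.T z)) := by
  rw [weight, inner_add_left, Real.exp_add, ← mul_assoc, weight]

lemma partition_pos (E : ExpFamily ν Θ d) {x : EuclideanSpace ℝ (Fin d)}
    (hx : x ∈ E.naturalSpace) : 0 < E.partition x := by
  refine lt_of_le_of_ne (integral_nonneg (E.weight_nonneg x)) (fun h => E.h_ne_zero ?_)
  have := (integral_eq_zero_iff_of_nonneg (E.weight_nonneg x) hx).1 h.symm
  filter_upwards [this] with z hz
  simpa [weight, (Real.exp_pos _).ne'] using hz

lemma normalizer_pos (E : ExpFamily ν Θ d) {x : EuclideanSpace ℝ (Fin d)}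
    (hx : x ∈ E.naturalSpace) : 0 < E.normalizer x := inv_pos.2 (E.partition_pos hx)

lemma normalizer_of_notMem (E : ExpFamily ν Θ d) {x : EuclideanSpace ℝ (Fin d)}
    (hx : x ∉ E.naturalSpace) : E.normalizer x = 0 := by
  rw [normalizer, integral_undef hx, inv_zero]

lemma convex_naturalSpace (E : ExpFamily ν Θ d) : Convex ℝ E.naturalSpace := by
  intro x hx y hy a b ha hb hab
  refine Integrable.mono' (((E.integrable_weight hx).const_mul a).add
    ((E.integrable_weight hy).const_mul b))
    (E.measurable_weight _).aestronglyMeasurable (Eventually.of_forall fun z => ?_)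
  rw [Real.norm_of_nonneg (mul_nonneg (E.h_nonneg z) (Real.exp_pos _).le)]
  have hexp := convexOn_exp.2 (Set.mem_univ (inner ℝ x (E.T z))) (Set.mem_univ (inner ℝ y (E.T z)))
    ha hb hab
  simp only [smul_eq_mul] at hexp
  simp only [weight, Pi.add_apply, inner_add_left, real_inner_smul_left]
  calc _ ≤ E.h z * (a * Real.exp (inner ℝ x (E.T z)) + b * Real.exp (inner ℝ y (E.T z))) :=
        mul_le_mul_of_nonneg_left hexp (E.h_nonneg z)
    _ = _ := by ring

lemma measurable_ofReal_weight (E : ExpFamily ν Θ d) (x : EuclideanSpace ℝ (Fin d)) :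
    Measurable fun z => ENNReal.ofReal (E.weight x z) := (E.measurable_weight x).ennreal_ofReal

lemma integrable_withDensity_weight (E : ExpFamily ν Θ d) (x : EuclideanSpace ℝ (Fin d))
    (φ : X → ℝ) : Integrable φ (ν.withDensity fun z => ENNReal.ofReal (E.weight x z)) ↔
      Integrable (fun z => E.weight x z * φ z) ν := by
  rw [integrable_withDensity_iff_integrable_smul' (E.measurable_ofReal_weight x)
    (Eventually.of_forall fun z => ENNReal.ofReal_lt_top)]
  simp only [ENNReal.toReal_ofReal (E.weight_nonneg x _), smul_eq_mul]

lemma integral_withDensity_weight (E : ExpFamily ν Θ d) (x : EuclideanSpace ℝ (Fin d))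
    (φ : X → ℝ) : ∫ z, φ z ∂(ν.withDensity fun z => ENNReal.ofReal (E.weight x z)) =
      ∫ z, E.weight x z * φ z ∂ν := by
  rw [integral_withDensity_eq_integral_toReal_smul (E.measurable_ofReal_weight x)
    (Eventually.of_forall fun z => ENNReal.ofReal_lt_top)]
  simp only [ENNReal.toReal_ofReal (E.weight_nonneg x _), smul_eq_mul]

/-- Along a line in parameter space, the partition function is the moment generating function of a
component of `T`, under the finite measure with density `weight x`. -/
lemma partition_add_smul (E : ExpFamily ν Θ d) (x v : EuclideanSpace ℝ (Fin d)) (t : ℝ) :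
    E.partition (x + t • v) = mgf (fun z => inner ℝ v (E.T z))
      (ν.withDensity fun z => ENNReal.ofReal (E.weight x z)) t := by
  rw [mgf, integral_withDensity_weight, partition]
  simp only [weight_add, real_inner_smul_left]

lemma zero_mem_interior_integrableExpSet (E : ExpFamily ν Θ d) (hreg : IsOpen E.naturalSpace)
    {x : EuclideanSpace ℝ (Fin d)} (hx : x ∈ E.naturalSpace) (v : EuclideanSpace ℝ (Fin d)) :
    0 ∈ interior (integrableExpSet (fun z => inner ℝ v (E.T z))
      (ν.withDensity fun z => ENNReal.ofReal (E.weight x z))) := by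
  have heq : integrableExpSet (fun z => inner ℝ v (E.T z))
      (ν.withDensity fun z => ENNReal.ofReal (E.weight x z)) =
      (fun t : ℝ => x + t • v) ⁻¹' E.naturalSpace := by
    ext t
    change Integrable _ _ ↔ Integrable (E.weight (x + t • v)) ν
    rw [integrable_withDensity_weight]
    have : E.weight (x + t • v) =
        fun z => E.weight x z * Real.exp (t * inner ℝ v (E.T z)) := by
      funext z; rw [weight_add, real_inner_smul_left]
    rw [this]
  rw [heq, (hreg.preimage (by fun_prop)).interior_eq]
  simpa using hx

lemma integrable_weight_mul_inner (E : ExpFamily ν Θ d) (hreg : IsOpen E.naturalSpace)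
    {x : EuclideanSpace ℝ (Fin d)} (hx : x ∈ E.naturalSpace) (v : EuclideanSpace ℝ (Fin d)) :
    Integrable (fun z => E.weight x z * inner ℝ v (E.T z)) ν := by
  have := integrable_pow_of_mem_interior_integrableExpSet
    (E.zero_mem_interior_integrableExpSet hreg hx v) 1
  simpa using (E.integrable_withDensity_weight x _).1 this

lemma integrable_weight_smul (E : ExpFamily ν Θ d) (hreg : IsOpen E.naturalSpace)
    {x : EuclideanSpace ℝ (Fin d)} (hx : x ∈ E.naturalSpace) :
    Integrable (fun z => E.weight x z • E.T z) ν := by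
  refine Integrable.of_eval_piLp fun i => ?_
  have := E.integrable_weight_mul_inner hreg hx (EuclideanSpace.single i 1)
  simpa [EuclideanSpace.inner_single_left] using this

lemma integral_weight_mul_inner (E : ExpFamily ν Θ d) (hreg : IsOpen E.naturalSpace)
    {x : EuclideanSpace ℝ (Fin d)} (hx : x ∈ E.naturalSpace) (v : EuclideanSpace ℝ (Fin d)) :
    ∫ z, E.weight x z * inner ℝ v (E.T z) ∂ν = E.partition x * inner ℝ (E.meanT x) v := by
  rw [meanT, real_inner_smul_left, normalizer_eq_inv_partition, ← mul_assoc,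
    mul_inv_cancel₀ (E.partition_pos hx).ne', one_mul, real_inner_comm,
    ← integral_inner (E.integrable_weight_smul hreg hx)]
  simp only [real_inner_smul_right]

lemma hasLineDerivAt_partition (E : ExpFamily ν Θ d) (hreg : IsOpen E.naturalSpace)
    {x : EuclideanSpace ℝ (Fin d)} (hx : x ∈ E.naturalSpace) (v : EuclideanSpace ℝ (Fin d)) :
    HasLineDerivAt ℝ E.partition (E.partition x * inner ℝ (E.meanT x) v) x v := by
  have := hasDerivAt_mgf (E.zero_mem_interior_integrableExpSet hreg hx v)
  rw [integral_withDensity_weight] at this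
  simp only [zero_mul, Real.exp_zero, mul_one] at this
  rw [E.integral_weight_mul_inner hreg hx v] at this
  rw [HasLineDerivAt]
  simpa only [partition_add_smul] using this

/-- Convexity of the log-partition function, in exponential form: Jensen's inequality for the
exponential under the law with natural parameter `x`. -/
lemma partition_mul_exp_le (E : ExpFamily ν Θ d) (hreg : IsOpen E.naturalSpace)
    {x y : EuclideanSpace ℝ (Fin d)} (hx : x ∈ E.naturalSpace) (hy : y ∈ E.naturalSpace) :
    E.partition x * Real.exp (inner ℝ (E.meanT x) (y - x)) ≤ E.partition y := by
  set c := inner ℝ (E.meanT x) (y - x)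
  have hint := E.integrable_weight_mul_inner hreg hx (y - x)
  have h1 : Integrable (fun z => Real.exp c * ((1 - c) * E.weight x z +
      E.weight x z * inner ℝ (y - x) (E.T z))) ν :=
    (((E.integrable_weight hx).const_mul _).add hint).const_mul _
  have h2 : ∫ z, Real.exp c * ((1 - c) * E.weight x z +
      E.weight x z * inner ℝ (y - x) (E.T z)) ∂ν = E.partition x * Real.exp c := by
    rw [integral_const_mul, integral_add ((E.integrable_weight hx).const_mul _) hint,
      integral_const_mul, E.integral_weight_mul_inner hreg hx]
    change Real.exp c * ((1 - c) * E.partition x + E.partition x * c) = _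
    ring
  rw [← h2]
  refine integral_mono h1 (E.integrable_weight hy) fun z => ?_
  have h3 : E.weight y z = E.weight x z * Real.exp (inner ℝ (y - x) (E.T z)) := by
    rw [← weight_add, add_sub_cancel]
  have h4 : Real.exp c * (inner ℝ (y - x) (E.T z) - c + 1) ≤
      Real.exp (inner ℝ (y - x) (E.T z)) := by
    calc _ ≤ Real.exp c * Real.exp (inner ℝ (y - x) (E.T z) - c) :=
          mul_le_mul_of_nonneg_left (Real.add_one_le_exp _) (Real.exp_pos _).le
      _ = _ := by rw [← Real.exp_add, add_sub_cancel]
  have h5 := mul_le_mul_of_nonneg_left h4 (E.weight_nonneg x z)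
  simp only [h3]
  linarith

/-- The normaliser extends continuously by zero across the boundary of the natural parameter space.
By Fatou's lemma, the integral of `weight` tends to infinity at every point outside. -/
lemma tendsto_normalizer (E : ExpFamily ν Θ d) {x : EuclideanSpace ℝ (Fin d)}
    (hx : x ∉ E.naturalSpace) : Tendsto E.normalizer (𝓝 x) (𝓝 0) := by
  set Λ : EuclideanSpace ℝ (Fin d) → ENNReal := fun y => ∫⁻ z, ENNReal.ofReal (E.weight y z) ∂ν
  have hΛx : Λ x = ⊤ := by
    by_contra hne
    exact hx ⟨(E.measurable_weight x).aestronglyMeasurable,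
      (hasFiniteIntegral_iff_ofReal (Eventually.of_forall (E.weight_nonneg x))).2
        (lt_top_iff_ne_top.2 hne)⟩
  have heq : E.normalizer = fun y => ((Λ y)⁻¹).toReal := by
    funext y
    by_cases hy : y ∈ E.naturalSpace
    · rw [normalizer_eq_inv_partition, partition,
        integral_eq_lintegral_of_nonneg_ae (Eventually.of_forall (E.weight_nonneg y))
          (E.measurable_weight y).aestronglyMeasurable, ENNReal.toReal_inv]
    · have : Λ y = ⊤ := by
        by_contra hne
        exact hy ⟨(E.measurable_weight y).aestronglyMeasurable,
          (hasFiniteIntegral_iff_ofReal (Eventually.of_forall (E.weight_nonneg y))).2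
            (lt_top_iff_ne_top.2 hne)⟩
      rw [E.normalizer_of_notMem hy, this, ENNReal.inv_top, ENNReal.toReal_zero]
  have hfatou : ∫⁻ z, liminf (fun y => ENNReal.ofReal (E.weight y z)) (𝓝 x) ∂ν ≤
      liminf Λ (𝓝 x) := lintegral_liminf_le fun y => E.measurable_ofReal_weight y
  have hlim : ∀ z, liminf (fun y => ENNReal.ofReal (E.weight y z)) (𝓝 x) =
      ENNReal.ofReal (E.weight x z) := fun z => by
    have hc : Continuous fun y => ENNReal.ofReal (E.weight y z) := by
      unfold weight
      exact ENNReal.continuous_ofReal.comp (by fun_prop)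
    exact (hc.tendsto x).liminf_eq
  simp only [hlim] at hfatou
  have htop : Tendsto Λ (𝓝 x) (𝓝 ⊤) :=
    tendsto_of_le_liminf_of_limsup_le (hΛx ▸ hfatou) le_top
  rw [heq]
  have h1 : Tendsto (fun y => (Λ y)⁻¹) (𝓝 x) (𝓝 0) := by
    simpa using tendsto_inv_iff.2 htop
  exact (ENNReal.tendsto_toReal ENNReal.zero_ne_top).comp h1

/-- The unnormalised conjugate density with hyperparameters `m` and `τ`. -/
def conjugateWeight (E : ExpFamily ν Θ d) (m : ℝ) (τ x : EuclideanSpace ℝ (Fin d)) : ℝ :=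
  E.normalizer x ^ m * Real.exp (inner ℝ x τ)

lemma conjugateWeight_nonneg (E : ExpFamily ν Θ d) (m : ℝ) (τ x : EuclideanSpace ℝ (Fin d)) :
    0 ≤ E.conjugateWeight m τ x := by
  refine mul_nonneg (Real.rpow_nonneg ?_ _) (Real.exp_pos _).le
  exact inv_nonneg.2 (integral_nonneg (E.weight_nonneg x))

lemma conjugateWeight_pos (E : ExpFamily ν Θ d) (m : ℝ) (τ : EuclideanSpace ℝ (Fin d))
    {x : EuclideanSpace ℝ (Fin d)} (hx : x ∈ E.naturalSpace) : 0 < E.conjugateWeight m τ x :=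
  mul_pos (Real.rpow_pos_of_pos (E.normalizer_pos hx) _) (Real.exp_pos _)

lemma log_conjugateWeight (E : ExpFamily ν Θ d) (m : ℝ) (τ : EuclideanSpace ℝ (Fin d))
    {x : EuclideanSpace ℝ (Fin d)} (hx : x ∈ E.naturalSpace) :
    Real.log (E.conjugateWeight m τ x) = m * Real.log (E.normalizer x) + inner ℝ x τ := by
  have h1 := E.normalizer_pos hx
  rw [conjugateWeight, Real.log_mul (Real.rpow_pos_of_pos h1 _).ne' (Real.exp_pos _).ne',
    Real.log_rpow h1, Real.log_exp]

lemma indicator_conjugateWeight (E : ExpFamily ν Θ d) {m : ℝ} (hm : 0 < m)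
    (τ : EuclideanSpace ℝ (Fin d)) :
    E.naturalSpace.indicator (fun x => Real.exp (inner ℝ x τ - m * Real.log (E.partition x))) =
      E.conjugateWeight m τ := by
  funext x
  by_cases hx : x ∈ E.naturalSpace
  · rw [Set.indicator_of_mem hx, ← Real.exp_log (E.conjugateWeight_pos m τ hx),
      E.log_conjugateWeight m τ hx, normalizer_eq_inv_partition, Real.log_inv]
    congr 1
    ring
  · rw [Set.indicator_of_notMem hx, conjugateWeight, E.normalizer_of_notMem hx,
      Real.zero_rpow hm.ne', zero_mul]

lemma isLogConcaveWithGradient (E : ExpFamily ν Θ d) (hreg : IsOpen E.naturalSpace) {m : ℝ}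
    (hm : 0 < m) (τ : EuclideanSpace ℝ (Fin d)) :
    IsLogConcaveWithGradient E.naturalSpace
      (fun x => inner ℝ x τ - m * Real.log (E.partition x)) (fun x => τ - m • E.meanT x) where
  isOpen := hreg
  convex := E.convex_naturalSpace
  le_add_inner x hx y hy := by
    have h1 := Real.log_le_log (mul_pos (E.partition_pos hx) (Real.exp_pos _))
      (E.partition_mul_exp_le hreg hx hy)
    rw [Real.log_mul (E.partition_pos hx).ne' (Real.exp_pos _).ne', Real.log_exp] at h1
    have h2 := mul_le_mul_of_nonneg_left h1 hm.le
    rw [inner_sub_left, real_inner_smul_left, inner_sub_right τ, real_inner_comm τ y,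
      real_inner_comm τ x]
    linarith
  hasLineDerivAt x hx v := by
    have h1 : HasDerivAt (fun t : ℝ => Real.log (E.partition (x + t • v)))
        (inner ℝ (E.meanT x) v) 0 := by
      have := (E.hasLineDerivAt_partition hreg hx v).log
        (by simpa using (E.partition_pos hx).ne')
      simpa [(E.partition_pos hx).ne'] using this
    have h2 : HasDerivAt (fun t : ℝ => inner ℝ (x + t • v) τ) (inner ℝ v τ) 0 := by
      simp only [inner_add_left, real_inner_smul_left]
      simpa using ((hasDerivAt_id (0 : ℝ)).mul_const (inner ℝ v τ)).const_add (inner ℝ x τ)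
    have h3 := h2.sub (h1.const_mul m)
    rw [HasLineDerivAt, inner_sub_left, real_inner_smul_left, real_inner_comm v τ]
    exact h3
  tendsto_zero x hx := by
    rw [E.indicator_conjugateWeight hm τ]
    have h1 : Tendsto (fun y => E.normalizer y ^ m) (𝓝 x) (𝓝 (0 ^ m)) :=
      (E.tendsto_normalizer hx).rpow_const (Or.inr hm.le)
    have h2 : Tendsto (fun y => Real.exp (inner ℝ y τ)) (𝓝 x) (𝓝 (Real.exp (inner ℝ x τ))) :=
      Continuous.tendsto (by fun_prop) x
    have h3 := h1.mul h2
    rwa [Real.zero_rpow hm.ne', zero_mul] at h3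

section SFinite

variable [SFinite ν]

lemma stronglyMeasurable_normalizer (E : ExpFamily ν Θ d) : StronglyMeasurable E.normalizer := by
  have h : Measurable fun p : EuclideanSpace ℝ (Fin d) × X => E.weight p.1 p.2 :=
    (E.measurable_h.comp measurable_snd).mul (Real.measurable_exp.comp
      (measurable_fst.inner (E.measurable_T.comp measurable_snd)))
  exact (h.stronglyMeasurable.integral_prod_right (ν := ν)).measurable.inv.stronglyMeasurable

lemma stronglyMeasurable_meanT (E : ExpFamily ν Θ d) : StronglyMeasurable E.meanT := by
  have h : Measurable fun p : EuclideanSpace ℝ (Fin d) × X => E.weight p.1 p.2 • E.T p.2 :=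
    ((E.measurable_h.comp measurable_snd).mul (Real.measurable_exp.comp
      (measurable_fst.inner (E.measurable_T.comp measurable_snd)))).smul
      (E.measurable_T.comp measurable_snd)
  exact E.stronglyMeasurable_normalizer.smul
    (h.stronglyMeasurable.integral_prod_right (ν := ν))

lemma measurable_conjugateWeight (E : ExpFamily ν Θ d) (m : ℝ) (τ : EuclideanSpace ℝ (Fin d)) :
    Measurable (E.conjugateWeight m τ) :=
  (E.stronglyMeasurable_normalizer.measurable.pow_const m).mul (by fun_prop)

/-- **Posterior linearity of the mean** (Diaconis and Ylvisaker): under the conjugate density with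
hyperparameters `m` and `τ`, the mean of the sufficient statistic has expectation `τ / m`. -/
theorem integral_conjugateWeight_mul_meanT (E : ExpFamily ν Θ d) (hreg : IsOpen E.naturalSpace)
    {m : ℝ} (hm : 0 < m) (τ : EuclideanSpace ℝ (Fin d))
    (hint : IntegrableOn (E.conjugateWeight m τ) E.naturalSpace)
    (v : EuclideanSpace ℝ (Fin d)) :
    IntegrableOn (fun x => E.conjugateWeight m τ x * inner ℝ (E.meanT x) v) E.naturalSpace ∧
      ∫ x in E.naturalSpace, E.conjugateWeight m τ x * inner ℝ (E.meanT x) v =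
        inner ℝ τ v / m * ∫ x in E.naturalSpace, E.conjugateWeight m τ x := by
  have hN := hreg.measurableSet
  have hp := E.indicator_conjugateWeight hm τ
  have hpN : ∀ x ∈ E.naturalSpace, Real.exp (inner ℝ x τ - m * Real.log (E.partition x)) =
      E.conjugateWeight m τ x := fun x hx => by
    rw [← hp, Set.indicator_of_mem hx]
  have hint' : Integrable (E.naturalSpace.indicator
      fun x => Real.exp (inner ℝ x τ - m * Real.log (E.partition x))) volume := by
    rw [integrable_indicator_iff hN]
    exact hint.congr_fun (fun x hx => (hpN x hx).symm) hN
  obtain ⟨h1, h2⟩ := (E.isLogConcaveWithGradient hreg hm τ).integral_inner_eq_zero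
    (stronglyMeasurable_const.sub (E.stronglyMeasurable_meanT.const_smul m)).aestronglyMeasurable
    hint' v
  have h1' : IntegrableOn (fun x => E.conjugateWeight m τ x * inner ℝ (τ - m • E.meanT x) v)
      E.naturalSpace := h1.congr_fun (fun x hx => by simp only [hpN x hx]) hN
  have h2' : ∫ x in E.naturalSpace, E.conjugateWeight m τ x * inner ℝ (τ - m • E.meanT x) v
      = 0 := by
    rw [← h2]
    exact setIntegral_congr_fun hN fun x hx => by simp only [hpN x hx]
  have heq : ∀ x, E.conjugateWeight m τ x * inner ℝ (E.meanT x) v =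
      inner ℝ τ v / m * E.conjugateWeight m τ x -
        m⁻¹ * (E.conjugateWeight m τ x * inner ℝ (τ - m • E.meanT x) v) := fun x => by
    rw [inner_sub_left, real_inner_smul_left]
    field_simp
    ring
  simp only [heq]
  refine ⟨(hint.const_mul _).sub (h1'.const_mul _), ?_⟩
  rw [integral_sub (hint.const_mul _) (h1'.const_mul _), integral_const_mul, integral_const_mul,
    h2', mul_zero, sub_zero]

end SFinite

end ExpFamily

/-! ### Bayes' theorem for dominated kernels -/

section Bayes

variable {Ω 𝓧 : Type*} [MeasurableSpace Ω] [MeasurableSpace 𝓧]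

lemma lintegral_pi_prod {n : ℕ} (ν : Measure 𝓧) [SigmaFinite ν] {f : Fin n → 𝓧 → ENNReal}
    (hf : ∀ i, Measurable (f i)) :
    ∫⁻ z, ∏ i, f i (z i) ∂(Measure.pi fun _ : Fin n => ν) = ∏ i, ∫⁻ x, f i x ∂ν := by
  induction n with
  | zero => simp
  | succ n ih =>
    have hmp := (measurePreserving_piFinSuccAbove (fun _ : Fin (n + 1) => ν) 0).symm
    rw [← hmp.lintegral_comp_emb (MeasurableEquiv.measurableEmbedding _)]
    simp_rw [MeasurableEquiv.piFinSuccAbove_symm_apply, Fin.insertNthEquiv, Fin.prod_univ_succ,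
      Fin.insertNth_zero]
    simp only [Equiv.coe_fn_mk, Fin.cons_zero, Fin.cons_succ, cast_eq]
    rw [lintegral_prod_mul (f := f 0)
      (g := fun x : Fin n → 𝓧 => ∏ j : Fin n, f j.succ (x j)) (hf 0).aemeasurable
      (Finset.measurable_prod _ fun i _ =>
        (hf i.succ).comp (measurable_pi_apply i)).aemeasurable, ih fun i => hf i.succ]

lemma pi_withDensity {n : ℕ} (ν : Measure 𝓧) [SigmaFinite ν] {f : 𝓧 → ENNReal}
    (hf : Measurable f) [SigmaFinite (ν.withDensity f)] :
    Measure.pi (fun _ : Fin n => ν.withDensity f) =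
      (Measure.pi fun _ : Fin n => ν).withDensity fun z => ∏ i, f (z i) := by
  refine Measure.pi_eq fun s hs => ?_
  rw [withDensity_apply _ (MeasurableSet.univ_pi hs),
    ← lintegral_indicator (MeasurableSet.univ_pi hs)]
  have : ∀ z : Fin n → 𝓧, (Set.univ.pi s).indicator (fun z => ∏ i, f (z i)) z =
      ∏ i, (s i).indicator f (z i) := by
    intro z
    by_cases hz : z ∈ Set.univ.pi s
    · rw [Set.indicator_of_mem hz]
      exact Finset.prod_congr rfl fun i _ => (Set.indicator_of_mem (hz i (Set.mem_univ i)) f).symm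
    · rw [Set.indicator_of_notMem hz]
      obtain ⟨i, hi⟩ : ∃ i, z i ∉ s i := by simpa [Set.mem_pi] using hz
      exact (Finset.prod_eq_zero (Finset.mem_univ i) (Set.indicator_of_notMem hi f)).symm
  simp only [this]
  rw [lintegral_pi_prod ν fun i => hf.indicator (hs i)]
  exact Finset.prod_congr rfl fun i _ => by
    rw [lintegral_indicator (hs i), withDensity_apply _ (hs i)]

lemma map_withDensity_comp {Y : Type*} [MeasurableSpace Y] (μ : Measure Ω) {e : Ω → Y}
    (he : Measurable e) {F : Y → ENNReal} (hF : Measurable F) :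
    (μ.withDensity fun ω => F (e ω)).map e = (μ.map e).withDensity F := by
  ext s hs
  rw [Measure.map_apply he hs, withDensity_apply _ (he hs), withDensity_apply _ hs,
    Measure.restrict_map he hs, lintegral_map hF he]

variable (μ : Measure Ω) [IsProbabilityMeasure μ] (κ : Kernel Ω 𝓧)
  (lam : Measure 𝓧) [SFinite lam] {f : Ω → 𝓧 → ENNReal}

lemma bind_eq_withDensity (hf : Measurable (Function.uncurry f))
    (hκ : ∀ ω, κ ω = lam.withDensity (f ω)) :
    μ.bind κ = lam.withDensity fun x => ∫⁻ ω, f ω x ∂μ := by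
  ext s hs
  rw [Measure.bind_apply hs κ.measurable.aemeasurable, withDensity_apply _ hs]
  simp only [hκ, withDensity_apply _ hs]
  exact lintegral_lintegral_swap hf.aemeasurable

variable [IsMarkovKernel κ]

/-- The marginal density of a dominated kernel is almost surely positive and finite. -/
lemma ae_bind_evidence (hf : Measurable (Function.uncurry f))
    (hκ : ∀ ω, κ ω = lam.withDensity (f ω)) :
    ∀ᵐ x ∂(μ.bind κ), ∫⁻ ω, f ω x ∂μ ≠ 0 ∧ ∫⁻ ω, f ω x ∂μ ≠ ⊤ := by
  have hq : Measurable fun x => ∫⁻ ω, f ω x ∂μ := hf.lintegral_prod_left'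
  have hbind := bind_eq_withDensity μ κ lam hf hκ
  have hfin : ∫⁻ x, ∫⁻ ω, f ω x ∂μ ∂lam ≠ ⊤ := by
    have h1 : lam.withDensity (fun x => ∫⁻ ω, f ω x ∂μ) Set.univ ≠ ⊤ := by
      rw [← hbind]; exact measure_ne_top _ _
    rwa [withDensity_apply _ MeasurableSet.univ, Measure.restrict_univ] at h1
  rw [hbind, ae_withDensity_iff hq]
  filter_upwards [ae_lt_top hq hfin] with x hx h0
  exact ⟨h0, hx.ne⟩

/-- **Bayes' theorem** for a dominated kernel: the posterior has density `f ω x / q x` with respect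
to the prior, where `q` is the marginal density of the data. -/
lemma posterior_eq_withDensity_div [StandardBorelSpace Ω] [Nonempty Ω]
    (hf : Measurable (Function.uncurry f)) (hκ : ∀ ω, κ ω = lam.withDensity (f ω)) :
    ∀ᵐ x ∂(μ.bind κ), posterior κ μ x =
      μ.withDensity fun ω => f ω x * (∫⁻ ω, f ω x ∂μ)⁻¹ := by
  set q : 𝓧 → ENNReal := fun x => ∫⁻ ω, f ω x ∂μ with hqdef
  have hq : Measurable q := hf.lintegral_prod_left'
  have hfx : ∀ x, Measurable fun ω => f ω x := fun x => hf.comp measurable_prodMk_right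
  have hg : Measurable (Function.uncurry fun x ω => f ω x * (q x)⁻¹) :=
    (hf.comp measurable_swap).mul (hq.comp measurable_fst).inv
  set ρ : Kernel 𝓧 Ω := (Kernel.const 𝓧 μ).withDensity fun x ω => f ω x * (q x)⁻¹ with hρ
  have hρx : ∀ x, ρ x = μ.withDensity fun ω => f ω x * (q x)⁻¹ := fun x => by
    rw [hρ, Kernel.withDensity_apply _ hg, Kernel.const_apply]
  have : IsFiniteKernel ρ := by
    refine ⟨1, ENNReal.one_lt_top, fun x => ?_⟩
    rw [hρx, withDensity_apply _ MeasurableSet.univ, Measure.restrict_univ,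
      lintegral_mul_const _ (hfx x)]
    exact ENNReal.mul_inv_le_one _
  -- By uniqueness of the posterior, the joint laws need only be compared.
  have hmain : (μ.bind κ) ⊗ₘ ρ = (μ ⊗ₘ κ).map Prod.swap := by
    ext s hs
    have hbind := bind_eq_withDensity μ κ lam hf hκ
    have hind : Measurable fun p : 𝓧 × Ω => s.indicator (fun p => f p.2 p.1) p :=
      (hf.comp measurable_swap).indicator hs
    rw [Measure.compProd_apply hs, Measure.map_apply measurable_swap hs,
      Measure.compProd_apply (measurable_swap hs), hbind,
      lintegral_withDensity_eq_lintegral_mul _ hq (Kernel.measurable_kernel_prodMk_left hs)]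
    have hfin : ∀ᵐ x ∂lam, q x < ⊤ := by
      refine ae_lt_top hq ?_
      have h1 : lam.withDensity q Set.univ ≠ ⊤ := by
        rw [← hbind]; exact measure_ne_top _ _
      rwa [withDensity_apply _ MeasurableSet.univ, Measure.restrict_univ] at h1
    have hL : ∫⁻ x, (q * fun x => ρ x (Prod.mk x ⁻¹' s)) x ∂lam =
        ∫⁻ x, ∫⁻ ω, s.indicator (fun p => f p.2 p.1) (x, ω) ∂μ ∂lam := by
      refine lintegral_congr_ae ?_
      filter_upwards [hfin] with x hx
      have hsx : MeasurableSet (Prod.mk x ⁻¹' s) := measurable_prodMk_left hs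
      have hi : ∀ ω, s.indicator (fun p => f p.2 p.1) (x, ω) =
          (Prod.mk x ⁻¹' s).indicator (fun ω => f ω x) ω := fun ω => rfl
      simp only [Pi.mul_apply, hi]
      rw [lintegral_indicator hsx, hρx, withDensity_apply _ hsx, lintegral_mul_const _ (hfx x)]
      by_cases h0 : q x = 0
      · rw [h0, zero_mul]
        exact (le_antisymm ((setLIntegral_le_lintegral _ _).trans h0.le) bot_le).symm
      · rw [mul_comm, mul_assoc, ENNReal.inv_mul_cancel h0 hx.ne, mul_one]
    have hR : ∫⁻ ω, κ ω (Prod.mk ω ⁻¹' (Prod.swap ⁻¹' s)) ∂μ =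
        ∫⁻ ω, ∫⁻ x, s.indicator (fun p => f p.2 p.1) (x, ω) ∂lam ∂μ := by
      refine lintegral_congr fun ω => ?_
      have hsx : MeasurableSet (Prod.mk ω ⁻¹' (Prod.swap ⁻¹' s)) :=
        measurable_prodMk_left (measurable_swap hs)
      have hi : ∀ x, s.indicator (fun p => f p.2 p.1) (x, ω) =
          (Prod.mk ω ⁻¹' (Prod.swap ⁻¹' s)).indicator (f ω) x := fun x => rfl
      simp only [hi]
      rw [lintegral_indicator hsx, hκ, withDensity_apply _ hsx]
    rw [hL, hR]
    exact lintegral_lintegral_swap hind.aemeasurable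
  filter_upwards [ae_eq_posterior_of_compProd_eq hmain] with x hx
  rw [← hx, hρx]

end Bayes

/-! ### Log loss under the posterior -/

lemma integral_neg_sub_const_sub {Ω : Type*} [MeasurableSpace Ω] {μ : Measure Ω}
    [IsProbabilityMeasure μ] {u w : Ω → ℝ} (hu : Integrable u μ) (hw : Integrable w μ) (b : ℝ) :
    ∫ ω, (-u ω - b - w ω) ∂μ = -∫ ω, u ω ∂μ - b - ∫ ω, w ω ∂μ := by
  have h1 : Integrable (fun ω => -u ω) μ := hu.neg
  have h2 : Integrable (fun ω => -u ω - b) μ := h1.sub (integrable_const b)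
  rw [integral_sub h2 hw, integral_sub h1 (integrable_const b), integral_neg]
  simp

namespace ExpFamily

variable {X : Type*} [MeasurableSpace X] {ν : Measure X}
  {Θ : Type*} [MeasurableSpace Θ] {d : ℕ}

lemma density_eq_mul_weight (E : ExpFamily ν Θ d) (t : Θ) (z : X) :
    E.density t z = E.normalizer (E.η t) * E.weight (E.η t) z := by
  rw [density, weight]; ring

lemma η_mem_naturalSpace (E : ExpFamily ν Θ d) (t : Θ) : E.η t ∈ E.naturalSpace :=
  E.integrable_η t

lemma density_nonneg (E : ExpFamily ν Θ d) (t : Θ) (z : X) : 0 ≤ E.density t z := by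
  rw [density_eq_mul_weight]
  exact mul_nonneg (E.normalizer_pos (E.η_mem_naturalSpace t)).le (E.weight_nonneg _ z)

lemma measurable_density_right (E : ExpFamily ν Θ d) (t : Θ) : Measurable (E.density t) := by
  have : E.density t = fun z => E.normalizer (E.η t) * E.weight (E.η t) z :=
    funext (E.density_eq_mul_weight t)
  rw [this]
  exact (E.measurable_weight _).const_mul _

lemma integrable_law_iff (E : ExpFamily ν Θ d) (t : Θ) (φ : X → ℝ) :
    Integrable φ (E.law t) ↔ Integrable (fun z => E.density t z * φ z) ν := by
  rw [law, integrable_withDensity_iff_integrable_smul'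
    (E.measurable_density_right t).ennreal_ofReal
    (Filter.Eventually.of_forall fun z => ENNReal.ofReal_lt_top)]
  simp only [ENNReal.toReal_ofReal (E.density_nonneg t _), smul_eq_mul]

lemma integral_law (E : ExpFamily ν Θ d) (t : Θ) (φ : X → ℝ) :
    ∫ z, φ z ∂(E.law t) = ∫ z, E.density t z * φ z ∂ν := by
  rw [law, integral_withDensity_eq_integral_toReal_smul
    (E.measurable_density_right t).ennreal_ofReal
    (Filter.Eventually.of_forall fun z => ENNReal.ofReal_lt_top)]
  simp only [ENNReal.toReal_ofReal (E.density_nonneg t _), smul_eq_mul]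

lemma ae_law_h_ne_zero (E : ExpFamily ν Θ d) (t : Θ) : ∀ᵐ z ∂(E.law t), E.h z ≠ 0 := by
  rw [law, ae_withDensity_iff (E.measurable_density_right t).ennreal_ofReal]
  refine Filter.Eventually.of_forall fun z hz h0 => hz ?_
  rw [density, h0, zero_mul, zero_mul, ENNReal.ofReal_zero]

lemma integrable_inner_law (E : ExpFamily ν Θ d) (hreg : IsOpen E.naturalSpace) (t : Θ)
    (v : EuclideanSpace ℝ (Fin d)) : Integrable (fun z => inner ℝ v (E.T z)) (E.law t) := by
  rw [integrable_law_iff]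
  simp only [density_eq_mul_weight, mul_assoc]
  exact (E.integrable_weight_mul_inner hreg (E.η_mem_naturalSpace t) v).const_mul _

lemma integral_inner_law (E : ExpFamily ν Θ d) (hreg : IsOpen E.naturalSpace) (t : Θ)
    (v : EuclideanSpace ℝ (Fin d)) :
    ∫ z, inner ℝ v (E.T z) ∂(E.law t) = inner ℝ (E.meanT (E.η t)) v := by
  rw [integral_law]
  simp only [density_eq_mul_weight, mul_assoc]
  rw [integral_const_mul, E.integral_weight_mul_inner hreg (E.η_mem_naturalSpace t),
    normalizer_eq_inv_partition, ← mul_assoc,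
    inv_mul_cancel₀ (E.partition_pos (E.η_mem_naturalSpace t)).ne', one_mul]

/-- Where the carrier does not vanish, log loss is affine in `log h` and `T`.  At zeros of `h` the
formula fails, since `Real.log 0 = 0`. -/
lemma loss_eq (E : ExpFamily ν Θ d) {z : X} (hz : E.h z ≠ 0) (θ : Θ) :
    E.loss z θ = -Real.log (E.h z) - Real.log (E.normalizer (E.η θ)) -
      inner ℝ (E.η θ) (E.T z) := by
  rw [loss, density, Real.log_mul (mul_ne_zero hz
    (E.normalizer_pos (E.η_mem_naturalSpace θ)).ne') (Real.exp_pos _).ne',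
    Real.log_mul hz (E.normalizer_pos (E.η_mem_naturalSpace θ)).ne', Real.log_exp]
  ring

lemma integrable_loss_law (E : ExpFamily ν Θ d) (hreg : IsOpen E.naturalSpace) {t : Θ}
    (hlog : Integrable (fun z => Real.log (E.h z)) (E.law t)) (θ : Θ) :
    Integrable (fun z => E.loss z θ) (E.law t) := by
  refine ((hlog.neg.sub (integrable_const (Real.log (E.normalizer (E.η θ))))).sub
    (E.integrable_inner_law hreg t (E.η θ))).congr ?_
  filter_upwards [E.ae_law_h_ne_zero t] with z hz
  simp only [E.loss_eq hz, Pi.sub_apply, Pi.neg_apply]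

lemma testLoss_eq (E : ExpFamily ν Θ d) (hreg : IsOpen E.naturalSpace) {t : Θ}
    (hlog : Integrable (fun z => Real.log (E.h z)) (E.law t)) (θ : Θ) :
    E.testLoss θ t = -∫ z, Real.log (E.h z) ∂(E.law t) - Real.log (E.normalizer (E.η θ)) -
      inner ℝ (E.meanT (E.η t)) (E.η θ) := by
  have h1 : E.testLoss θ t = ∫ z, (-Real.log (E.h z) - Real.log (E.normalizer (E.η θ))) -
      inner ℝ (E.η θ) (E.T z) ∂(E.law t) := by
    refine integral_congr_ae ?_
    filter_upwards [E.ae_law_h_ne_zero t] with z hz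
    exact E.loss_eq hz θ
  rw [h1, integral_neg_sub_const_sub hlog (E.integrable_inner_law hreg t _),
    E.integral_inner_law hreg]

/-- The sum of the sufficient statistic over the training set. -/
def sumT (E : ExpFamily ν Θ d) {n : ℕ} (Z : Fin n → X) : EuclideanSpace ℝ (Fin d) :=
  ∑ i, E.T (Z i)

/-- The likelihood of the training set `Z`, as a function of the natural parameter. -/
def likelihood (E : ExpFamily ν Θ d) {n : ℕ} (Z : Fin n → X) (x : EuclideanSpace ℝ (Fin d)) :
    ℝ := (∏ i, E.h (Z i)) * E.conjugateWeight n (E.sumT Z) x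

lemma prod_density_eq_likelihood (E : ExpFamily ν Θ d) {n : ℕ} (Z : Fin n → X) (θ : Θ) :
    ∏ i, E.density θ (Z i) = E.likelihood Z (E.η θ) := by
  simp only [density, Finset.prod_mul_distrib, Finset.prod_const, Finset.card_univ,
    Fintype.card_fin, likelihood, conjugateWeight, sumT, inner_sum, Real.exp_sum,
    Real.rpow_natCast]
  ring

lemma priorDensity_eq (E : ExpFamily ν Θ d) (n₀ : ℝ) (τ₀ x : EuclideanSpace ℝ (Fin d)) :
    E.priorDensity n₀ τ₀ x =
      (∫ y in E.naturalSpace, E.conjugateWeight n₀ τ₀ y)⁻¹ * E.conjugateWeight n₀ τ₀ x := rfl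

lemma IsConjugatePrior.integral_pos {E : ExpFamily ν Θ d} {n₀ : ℝ}
    {τ₀ : EuclideanSpace ℝ (Fin d)} {prior : Measure Θ} [IsProbabilityMeasure prior]
    (hprior : E.IsConjugatePrior n₀ τ₀ prior) :
    0 < ∫ y in E.naturalSpace, E.conjugateWeight n₀ τ₀ y := by
  refine lt_of_le_of_ne (integral_nonneg (E.conjugateWeight_nonneg n₀ τ₀)) fun h0 => ?_
  -- If the integral were zero, its junk inverse would make the prior the zero measure.
  have h1 : prior.map E.η = 0 := by
    rw [hprior.2]
    simp only [priorDensity_eq, ← h0, inv_zero, zero_mul, ENNReal.ofReal_zero]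
    exact withDensity_zero
  have h2 := (Measure.map_eq_zero_iff E.measurable_η.aemeasurable).1 h1
  exact IsProbabilityMeasure.ne_zero prior h2

lemma conjugateWeight_mul (E : ExpFamily ν Θ d) (m m' : ℝ) (τ τ' : EuclideanSpace ℝ (Fin d))
    {x : EuclideanSpace ℝ (Fin d)} (hx : x ∈ E.naturalSpace) :
    E.conjugateWeight m τ x * E.conjugateWeight m' τ' x =
      E.conjugateWeight (m' + m) (τ + τ') x := by
  rw [conjugateWeight, conjugateWeight, conjugateWeight, Real.rpow_add (E.normalizer_pos hx),
    inner_add_right, Real.exp_add]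
  ring

section Posterior

variable [SigmaFinite ν]

lemma sample_eq_withDensity (E : ExpFamily ν Θ d) (n : ℕ) (θ : Θ) :
    E.sample n θ = (Measure.pi fun _ : Fin n => ν).withDensity
      fun Z => ENNReal.ofReal (E.likelihood Z (E.η θ)) := by
  have hσ : IsProbabilityMeasure (ν.withDensity fun z => ENNReal.ofReal (E.density θ z)) :=
    E.isProbabilityMeasure_law θ
  have h1 : E.sample n θ = Measure.pi fun _ : Fin n =>
    ν.withDensity fun z => ENNReal.ofReal (E.density θ z) := rfl
  rw [h1, pi_withDensity ν (E.measurable_density_right θ).ennreal_ofReal]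
  congr 1
  funext Z
  rw [← prod_density_eq_likelihood, ENNReal.ofReal_prod_of_nonneg
    fun i _ => E.density_nonneg θ (Z i)]

lemma measurable_likelihood (E : ExpFamily ν Θ d) (n : ℕ) :
    Measurable (Function.uncurry fun (θ : Θ) (Z : Fin n → X) =>
      ENNReal.ofReal (E.likelihood Z (E.η θ))) := by
  simp only [← prod_density_eq_likelihood]
  refine Measurable.ennreal_ofReal ?_
  refine Finset.measurable_prod _ fun i _ => ?_
  exact E.measurable_density.comp
    (measurable_fst.prodMk ((measurable_pi_apply i).comp measurable_snd))

variable [StandardBorelSpace Θ] [Nonempty Θ]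

/-- Conjugacy: given the training set `Z`, the natural parameter has the conjugate density with
hyperparameters `n + n₀` and `τ₀ + ∑ T (Z i)`. -/
lemma ae_map_posteriorLaw (E : ExpFamily ν Θ d) (hreg : IsOpen E.naturalSpace)
    {n₀ : ℝ} {τ₀ : EuclideanSpace ℝ (Fin d)} (prior : Measure Θ) [IsProbabilityMeasure prior]
    (hprior : E.IsConjugatePrior n₀ τ₀ prior) (n : ℕ) :
    ∀ᵐ Z ∂(prior.bind (E.sample n)), (∀ i, E.h (Z i) ≠ 0) ∧ ∃ c : ℝ, 0 < c ∧
      (E.posteriorLaw prior Z).map E.η = (volume.restrict E.naturalSpace).withDensity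
        fun x => ENNReal.ofReal (c * E.conjugateWeight (n + n₀) (τ₀ + E.sumT Z) x) := by
  have hmeas := E.measurable_likelihood (n := n)
  have hκ := E.sample_eq_withDensity n
  filter_upwards [ae_bind_evidence prior (E.sample n) _ hmeas hκ,
    posterior_eq_withDensity_div prior (E.sample n) _ hmeas hκ] with Z hq hpost
  set q := ∫⁻ θ, ENNReal.ofReal (E.likelihood Z (E.η θ)) ∂prior
  have hh : ∀ i, E.h (Z i) ≠ 0 := by
    intro i h0
    apply hq.1
    have : ∀ x, E.likelihood Z x = 0 := fun x => by
      rw [likelihood, Finset.prod_eq_zero (Finset.mem_univ i) h0, zero_mul]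
    simp only [q, this, ENNReal.ofReal_zero, lintegral_zero]
  have hZ₀ := hprior.integral_pos
  set Z₀ := ∫ y in E.naturalSpace, E.conjugateWeight n₀ τ₀ y
  have hH : 0 < ∏ i, E.h (Z i) :=
    Finset.prod_pos fun i _ => lt_of_le_of_ne (E.h_nonneg _) (hh i).symm
  have hqpos : 0 < q.toReal := ENNReal.toReal_pos hq.1 hq.2
  refine ⟨hh, Z₀⁻¹ * (∏ i, E.h (Z i)) * q.toReal⁻¹, by positivity, ?_⟩
  have hlik : Measurable (E.likelihood Z) := (E.measurable_conjugateWeight _ _).const_mul _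
  have hF : Measurable fun x => ENNReal.ofReal (E.likelihood Z x) * q⁻¹ :=
    hlik.ennreal_ofReal.mul_const _
  have hprD : Measurable fun x => ENNReal.ofReal (E.priorDensity n₀ τ₀ x) := by
    simp only [priorDensity_eq]
    exact ((E.measurable_conjugateWeight _ _).const_mul _).ennreal_ofReal
  rw [posteriorLaw, hpost, map_withDensity_comp prior E.measurable_η hF, hprior.2,
    ← withDensity_mul _ hprD hF]
  refine withDensity_congr_ae ((ae_restrict_iff' hreg.measurableSet).2
    (Filter.Eventually.of_forall fun x hx => ?_))
  have hqinv : q⁻¹ = ENNReal.ofReal (q.toReal⁻¹) := by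
    rw [ENNReal.ofReal_inv_of_pos hqpos, ENNReal.ofReal_toReal hq.2]
  have h1 : 0 ≤ E.priorDensity n₀ τ₀ x :=
    mul_nonneg (inv_nonneg.2 hZ₀.le) (E.conjugateWeight_nonneg _ _ _)
  have h2 : 0 ≤ E.likelihood Z x := mul_nonneg hH.le (E.conjugateWeight_nonneg _ _ _)
  simp only [Pi.mul_apply]
  rw [hqinv, ← ENNReal.ofReal_mul h2, ← ENNReal.ofReal_mul h1, priorDensity_eq, likelihood,
    ← E.conjugateWeight_mul n₀ n τ₀ (E.sumT Z) hx]
  congr 1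
  ring

/-- The posterior expectation of the mean of `T` is `(τ₀ + ∑ T (Z i)) / (n + n₀)`. -/
lemma integral_meanT_posteriorLaw (E : ExpFamily ν Θ d) (hreg : IsOpen E.naturalSpace)
    (prior : Measure Θ) [IsProbabilityMeasure prior] {n : ℕ} {Z : Fin n → X} {m c : ℝ}
    (hm : 0 < m) (hc : 0 < c) {τ : EuclideanSpace ℝ (Fin d)}
    (hmap : (E.posteriorLaw prior Z).map E.η = (volume.restrict E.naturalSpace).withDensity
      fun x => ENNReal.ofReal (c * E.conjugateWeight m τ x))
    (v : EuclideanSpace ℝ (Fin d)) :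
    Integrable (fun t => inner ℝ (E.meanT (E.η t)) v) (E.posteriorLaw prior Z) ∧
      ∫ t, inner ℝ (E.meanT (E.η t)) v ∂(E.posteriorLaw prior Z) = inner ℝ τ v / m := by
  have hprob : IsProbabilityMeasure (E.posteriorLaw prior Z) := by
    rw [posteriorLaw]; infer_instance
  have hcw : Measurable fun x => c * E.conjugateWeight m τ x :=
    (E.measurable_conjugateWeight m τ).const_mul c
  have hcw0 : ∀ x, 0 ≤ c * E.conjugateWeight m τ x := fun x =>
    mul_nonneg hc.le (E.conjugateWeight_nonneg m τ x)
  have hmass : ∫⁻ x in E.naturalSpace, ENNReal.ofReal (c * E.conjugateWeight m τ x) = 1 := by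
    have h1 : (E.posteriorLaw prior Z).map E.η Set.univ = 1 := by
      rw [Measure.map_apply E.measurable_η MeasurableSet.univ, Set.preimage_univ, measure_univ]
    rwa [hmap, withDensity_apply _ MeasurableSet.univ, Measure.restrict_univ] at h1
  have hint' : IntegrableOn (fun x => c * E.conjugateWeight m τ x) E.naturalSpace := by
    refine ⟨hcw.aestronglyMeasurable, ?_⟩
    rw [hasFiniteIntegral_iff_ofReal (Filter.Eventually.of_forall hcw0), hmass]
    exact ENNReal.one_lt_top
  have hint : IntegrableOn (E.conjugateWeight m τ) E.naturalSpace := by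
    have h1 := Integrable.const_mul hint' c⁻¹
    simp only [← mul_assoc, inv_mul_cancel₀ hc.ne', one_mul] at h1
    exact h1
  have hone : c * ∫ x in E.naturalSpace, E.conjugateWeight m τ x = 1 := by
    rw [← integral_const_mul, integral_eq_lintegral_of_nonneg_ae
      (Filter.Eventually.of_forall hcw0) hcw.aestronglyMeasurable, hmass, ENNReal.toReal_one]
  obtain ⟨h1, h2⟩ := E.integral_conjugateWeight_mul_meanT hreg hm τ hint v
  have hsm : StronglyMeasurable fun x => inner ℝ (E.meanT x) v :=
    E.stronglyMeasurable_meanT.inner stronglyMeasurable_const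
  constructor
  · have h3 : Integrable (fun x => inner ℝ (E.meanT x) v)
        ((E.posteriorLaw prior Z).map E.η) := by
      rw [hmap, integrable_withDensity_iff_integrable_smul' hcw.ennreal_ofReal
        (Filter.Eventually.of_forall fun z => ENNReal.ofReal_lt_top)]
      simp only [ENNReal.toReal_ofReal (hcw0 _), smul_eq_mul, mul_assoc]
      exact h1.const_mul c
    exact h3.comp_measurable E.measurable_η
  · rw [← integral_map (f := fun x => inner ℝ (E.meanT x) v) E.measurable_η.aemeasurable
      hsm.aestronglyMeasurable, hmap, integral_withDensity_eq_integral_toReal_smul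
        hcw.ennreal_ofReal (Filter.Eventually.of_forall fun z => ENNReal.ofReal_lt_top)]
    simp only [ENNReal.toReal_ofReal (hcw0 _), smul_eq_mul, mul_assoc]
    rw [integral_const_mul, h2, mul_left_comm, hone, mul_one]

end Posterior

end ExpFamily

/-- A regularized loss that is an increasing affine function of the expected loss is perfect. -/
lemma isPerfectBayesOptimal_of_affine {Θ : Type*} {Lhat Lbar R : Θ → ℝ} {a K : ℝ} (ha : 0 < a)
    (h : ∀ θ, Lhat θ + R θ = a * Lbar θ + K) : IsPerfectBayesOptimal Lhat Lbar R := by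
  refine ⟨?_, fun y => a * y + K, fun y y' hy => ?_, h⟩
  · ext θ
    simp only [argminSet, Set.mem_ofPred_eq, h, add_le_add_iff_right, mul_le_mul_iff_right₀ ha]
  · exact add_le_add_left (mul_le_mul_of_nonneg_left hy ha.le) K

end

theorem theorem2 {X : Type*} [MeasurableSpace X] (ν : MeasureTheory.Measure X)
    [MeasureTheory.SigmaFinite ν]
    {Θ : Type*} [MeasurableSpace Θ] [StandardBorelSpace Θ] [Nonempty Θ] {d : ℕ}
    (E : ExpFamily ν Θ d) (hreg : IsOpen E.naturalSpace)
    (n₀ : ℝ) (τ₀ : EuclideanSpace ℝ (Fin d))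
    (prior : MeasureTheory.Measure Θ) [MeasureTheory.IsProbabilityMeasure prior]
    (hprior : E.IsConjugatePrior n₀ τ₀ prior)
    (n : ℕ) (hn : 0 < n) (hn₀ : 0 < (n : ℝ) + n₀)
    (hlog : ∀ᵐ Z ∂(prior.bind (E.sample n)),
      E.HasFiniteExpectation (E.posteriorLaw prior Z) (fun z => Real.log (E.h z))) :
    ∀ᵐ Z ∂(prior.bind (E.sample n)),
      (∀ θ, E.HasFiniteExpectation (E.posteriorLaw prior Z) (fun z => E.loss z θ)) ∧
      IsPerfectBayesOptimal (E.trainLoss Z) (E.expectedTestLoss prior Z)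
        (E.regularizer n₀ τ₀ n) ∧
      ∃ K : ℝ, ∀ θ, E.trainLoss Z θ + E.regularizer n₀ τ₀ n θ =
        ((n : ℝ) + n₀) / n * E.expectedTestLoss prior Z θ + K := by
  have hn' : (0 : ℝ) < n := Nat.cast_pos.2 hn
  filter_upwards [hlog, E.ae_map_posteriorLaw hreg prior hprior n] with Z hH hZ
  obtain ⟨hh, c, hc, hmap⟩ := hZ
  have hmean := E.integral_meanT_posteriorLaw hreg prior hn₀ hc hmap
  have hprob : IsProbabilityMeasure (E.posteriorLaw prior Z) := by
    rw [ExpFamily.posteriorLaw]; infer_instance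
  set ρ := E.posteriorLaw prior Z with hρ
  set H := ∫ t, ∫ z, Real.log (E.h z) ∂(E.law t) ∂ρ
  have htest : ∀ θ, E.testLoss θ =ᵐ[ρ] fun t => -∫ z, Real.log (E.h z) ∂(E.law t) -
      Real.log (E.normalizer (E.η θ)) - inner ℝ (E.meanT (E.η t)) (E.η θ) := fun θ => by
    filter_upwards [hH.1] with t ht
    exact E.testLoss_eq hreg ht θ
  have hbar : ∀ θ, E.expectedTestLoss prior Z θ = -H - Real.log (E.normalizer (E.η θ)) -
      inner ℝ (τ₀ + E.sumT Z) (E.η θ) / (n + n₀) := fun θ => by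
    rw [ExpFamily.expectedTestLoss, integral_congr_ae (htest θ),
      integral_neg_sub_const_sub hH.2 (hmean _).1, (hmean _).2]
  have htrain : ∀ θ, E.trainLoss Z θ = -(1 / n) * ∑ i, Real.log (E.h (Z i)) -
      Real.log (E.normalizer (E.η θ)) - inner ℝ (E.sumT Z) (E.η θ) / n := fun θ => by
    simp only [ExpFamily.trainLoss, E.loss_eq (hh _), Finset.sum_sub_distrib,
      Finset.sum_neg_distrib, Finset.sum_const, Finset.card_univ, Fintype.card_fin, nsmul_eq_mul]
    rw [← inner_sum, real_inner_comm, ← ExpFamily.sumT]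
    field_simp
  have hZ₀ := hprior.integral_pos
  set Z₀ := ∫ y in E.naturalSpace, E.conjugateWeight n₀ τ₀ y
  have hreg' : ∀ θ, E.regularizer n₀ τ₀ n θ = -(1 / n) * (-Real.log Z₀ +
      (n₀ * Real.log (E.normalizer (E.η θ)) + inner ℝ τ₀ (E.η θ))) := fun θ => by
    have hθ := E.η_mem_naturalSpace θ
    rw [ExpFamily.regularizer, ExpFamily.priorDensity_eq, Real.log_mul (inv_pos.2 hZ₀).ne'
      (E.conjugateWeight_pos n₀ τ₀ hθ).ne', Real.log_inv, E.log_conjugateWeight n₀ τ₀ hθ,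
      real_inner_comm τ₀]
  have haff : ∀ θ, E.trainLoss Z θ + E.regularizer n₀ τ₀ n θ =
      ((n : ℝ) + n₀) / n * E.expectedTestLoss prior Z θ +
        (((n : ℝ) + n₀) / n * H - (1 / n) * ∑ i, Real.log (E.h (Z i)) +
          (1 / n) * Real.log Z₀) := fun θ => by
    rw [hbar, htrain, hreg', inner_add_left]
    field_simp
    ring
  refine ⟨fun θ => ⟨?_, ?_⟩, isPerfectBayesOptimal_of_affine (div_pos hn₀ hn') haff, _, haff⟩
  · filter_upwards [hH.1] with t ht
    exact E.integrable_loss_law hreg ht θ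
  · exact ((hH.2.neg.sub (integrable_const _)).sub (hmean _).1).congr (htest θ).symm
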